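/- Let $\alpha,\beta$ be integers such that $0,\alpha,\beta$ are distinct, and let $B\in M_v(\mathbb Z)$ be an integral square matrix whose minimal polynomial over $\mathbb Q$ is $x(x-\alpha)(x-\beta)$. Let $\mathbb Z[B]=\{f(B)\mid f\in\mathbb Z[x]\}$. For a ring $R$ that has only finitely many ideals of each finite index $n\ge 1$, let $\zeta_R(s)=\sum_{n\ge1}a_n n^{-s}$ be the formal Dirichlet series in which $a_n$ is the number of ideals of $R$ of index $n$. Put $A=\mathbb Q[x]/x(x-\alpha)(x-\beta)\mathbb Q[x]$ and $\Lambda=\mathbb Z[x]/x(x-\alpha)(x-\beta)\mathbb Z[x]\subset A$. For a prime $p$ let $\mathbb Z_p=\{a/b\mid a,b\in\mathbb Z,\ p\nmid b\}$ be the localization of $\mathbb Z$ at $p$, and put $\Lambda_p=\mathbb Z_p\Lambda\subset A$ and $R_p=\mathbb Z_p[x]/x(x-\alpha)(x-\beta)\mathbb Z_p[x]$ (isomorphic to $\Lambda_p$). Call $p$ exceptional if $\Lambda_p$ is not a maximal $\mathbb Z_p$-order of $A$. Let $\zeta_V(s)$, for the regular module $V=A$, be the product of the Dedekind zeta functions of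 the simple components of $A$, and let $\zeta_V(s)_p$ be its Euler factor at $p$, i.e. the sum of its terms at the powers of $p$. Then the following hold. 1. $\mathbb Z[B]$ and every $R_p$ have only finitely many ideals of each finite index $n\geq 1$, so that $\zeta_{\mathbb Z[B]}(s)$ and $\zeta_{R_p}(s)$ are well defined. 2. The exceptional primes are exactly the prime divisors of $\alpha\beta(\beta-\alpha)$. Moreover, $\Lambda$ is contained in a maximal $\mathbb Z$-order of $A$, and for every maximal $\mathbb Z$-order $\Gamma\supseteq\Lambda$ of $A$ the index $|\Gamma:\Lambda|$ is finite and has exactly the same prime divisors. 3. $\zeta_V(s)=\zeta(s)^3$, where $\zeta(s)$ is the Riemann zeta function, and $\zeta_V(s)_p=(1-p^{-s})^{-3}$ for every prime $p$. 4. For every prime $p$ there is a polynomial $\delta_p(x)\in\mathbb Z[x]$ with $\delta_p(p^{-s})=\zeta_{R_p}(s)\,(1-p^{-s})^3$, and $$\zeta_{\mathbb Z[B]}(s)=\prod_{p\mid\alpha\beta(\beta-\alpha)}\delta_p(p^{-s})\cdot\zeta(s)^3,$$ where $p$ runs through the prime divisors of $\alpha\beta(\beta-\alpha)$. All these are identities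 of formal Dirichlet series. In addition, for every complex $s$ with $\operatorname{Re} s>1$ the series $\zeta_{\mathbb Z[B]}(s)$ converges absolutely and the last identity holds as an identity of complex numbers. -/

import Mathlib

open Polynomial

noncomputable section

namespace IdealZeta

/-! Formal Dirichlet series with integer coefficients are elements of `ArithmeticFunction ℤ`:
the series `∑_{n ≥ 1} a_n n^{-s}` is the function `n ↦ a_n` (with value `0` at `0`), and the product
is Dirichlet convolution. -/

/-- The index `|R : I|` of an ideal as an additive subgroup (`0` if the index is infinite). -/
def idealIndex {R : Type*} [Ring R] (I : Ideal R) : ℕ :=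
  (Submodule.toAddSubgroup I).index

/-- The set of ideals of `R` of index `n`. It is used for commutative rings `R`, where the left
ideals `Ideal R` are just the ideals. -/
def idealsOfIndex (R : Type*) [Ring R] (n : ℕ) : Set (Ideal R) :=
  {I | idealIndex I = n}

/-- The formal Dirichlet series `ζ_R(s) = ∑_{n ≥ 1} a_n n^{-s}`, where `a_n` is the number of ideals
of `R` of index `n`. -/
def ringZeta (R : Type*) [Ring R] : ArithmeticFunction ℤ :=
  ⟨fun n => if n = 0 then 0 else ((idealsOfIndex R n).ncard : ℤ), by simp⟩

/-- The formal Dirichlet series `m^{-s}` (for `m ≥ 1`): coefficient `1` at `m` and `0` elsewhere. -/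
def dirichletMonomial (m : ℕ) : ArithmeticFunction ℤ :=
  ⟨fun n => if n ≠ 0 ∧ n = m then 1 else 0, by simp⟩

/-- The `p`-part (Euler factor at `p`) of a formal Dirichlet series: the sum of its terms
at the powers of `p`. -/
def eulerFactor (p : ℕ) (f : ArithmeticFunction ℤ) : ArithmeticFunction ℤ :=
  open Classical in ⟨fun n => if ∃ k : ℕ, n = p ^ k then f n else 0, by simp⟩

/-- The localization `ℤ_(p) = {a / b : p ∤ b}` of `ℤ` at a prime `p`, as a subring of `ℚ`
(a denominator not divisible by the prime `p` is one that is coprime to `p`). -/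
def zLoc (p : ℕ) : Subring ℚ where
  carrier := {q | q.den.Coprime p}
  mul_mem' {a b} ha hb :=
    Nat.Coprime.coprime_dvd_left (Rat.mul_den_dvd a b) (Nat.Coprime.mul_left ha hb)
  one_mem' := by simp
  add_mem' {a b} ha hb :=
    Nat.Coprime.coprime_dvd_left (Rat.add_den_dvd a b) (Nat.Coprime.mul_left ha hb)
  zero_mem' := by simp
  neg_mem' {a} ha := by simpa using ha

/-- The polynomial `x (x - α) (x - β)` over `R`. -/
def cubic (R : Type*) [CommRing R] (α β : ℤ) : R[X] :=
  X * (X - C (α : R)) * (X - C (β : R))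

/-- The `ℚ`-algebra `A = ℚ[x] / x (x - α) (x - β) ℚ[x]`. -/
abbrev cubicAlgebra (α β : ℤ) : Type := AdjoinRoot (cubic ℚ α β)

/-- The local ring `R_p = ℤ_(p)[x] / x (x - α) (x - β) ℤ_(p)[x]`. -/
abbrev localRing (α β : ℤ) (p : ℕ) : Type := AdjoinRoot (cubic (zLoc p) α β)

/-- For `S = ℤ` this is `Λ = ℤ[x] / x (x - α) (x - β) ℤ[x]`, and for `S = ℤ_(p)` it is its
localization `Λ_p = ℤ_(p) Λ`, both seen inside `A`: the subring `S[x]` of `A`. -/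
def cubicOrder (S : Type*) [CommRing S] (α β : ℤ) [Algebra S (cubicAlgebra α β)] :
    Subalgebra S (cubicAlgebra α β) :=
  Algebra.adjoin S {AdjoinRoot.root (cubic ℚ α β)}

section Orders

variable {S A : Type*} [CommRing S] [CommRing A] [Algebra S A] [Algebra ℚ A]

/-- `O` is an `S`-order of the `ℚ`-algebra `A` (for `S` with field of fractions `ℚ`): a subring that
is a finitely generated `S`-module and spans `A` over `ℚ`. -/
def IsOrder (O : Subalgebra S A) : Prop :=
  (Subalgebra.toSubmodule O).FG ∧ Submodule.span ℚ (O : Set A) = ⊤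

/-- `O` is a maximal `S`-order of `A`. -/
def IsMaximalOrder (O : Subalgebra S A) : Prop :=
  IsOrder O ∧ ∀ O' : Subalgebra S A, IsOrder O' → O ≤ O' → O' = O

/-- The index of `O` in `O'`, for `O ≤ O'`, as additive groups. -/
def orderIndex (O O' : Subalgebra S A) : ℕ :=
  (Subalgebra.toSubmodule O).toAddSubgroup.relIndex (Subalgebra.toSubmodule O').toAddSubgroup

end Orders

/-- The exceptional primes of `Λ`: the primes `p` such that the localization `Λ_p` is not a maximal
`ℤ_(p)`-order of `A`. -/
def exceptionalPrimes (α β : ℤ) : Set ℕ :=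
  {p | p.Prime ∧ ¬ IsMaximalOrder (cubicOrder (zLoc p) α β)}

/-- The zeta function `ζ_V(s)` of the regular module `V = A` over a commutative semisimple
`ℚ`-algebra `A` of finite dimension: the product of the Dedekind zeta functions of the simple
components `A / m` of `A`, where `m` runs through the (finitely many) maximal ideals. The Dedekind
zeta function of a number field is the zeta function of its ring of integers. -/
def regularZeta (A : Type*) [CommRing A] : ArithmeticFunction ℤ :=
  ∏ᶠ m : MaximalSpectrum A, ringZeta (integralClosure ℤ (A ⧸ m.asIdeal))

end IdealZeta

end

open IdealZeta

open Polynomial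

noncomputable section

namespace IdealZeta

/-! ### Formal Dirichlet series and their Euler factors -/

/-! Write `D = αβ(β - α)`. Since the minimal polynomial is monic with integer coefficients, `ℤ[B]`
is isomorphic to `ℤ[x]/x(x-α)(x-β)`. An ideal of index `n` contains `n`, so the coefficient at `n`
depends only on the ring modulo `n`. The Chinese remainder theorem then makes the zeta function
multiplicative (`isMultiplicative_ringZeta`), and its Euler factor at `p` is the zeta function of
`R_p`, because `Λ → R_p` is an isomorphism modulo every `p^k`.

Evaluation at the three roots embeds `R_p` in `ℤ_(p)^3`, and Lagrange interpolation shows that the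
image contains `D ℤ_(p)^3`. If `p ∤ D` the embedding is an isomorphism and the Euler factor is `(1 -
p^{-s})^{-3}`.

For general `p`, let `p^r` be the `p`-part of `D`. A sublattice of finite index in `ℤ_(p)^3` is
uniquely `p^a M` with `a ∈ ℕ^3` and `M` primitive, that is, with surjective coordinate projections.
A primitive `M` contains `p^r ℤ_(p)^3`, so there are finitely many of them, and whether `p^a M ⊆
R_p` depends only on the truncations `min(a_i, r)`. The generating function of the admissible `a` is
therefore a finite sum of products of factors `X^b` and `X^r/(1-X)`, and `(1-X)^3` clears the
denominators (`mk_ncard_idealsOfIndex_mul_mem_polySeries`). This gives `δ_p`. Comparison at prime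
powers yields the formal identity (`eq_prod_aeval_mul_zeta_pow`), and absolutely convergent series
respect its sums and products.

As for orders, the elements of `A` with integral values at the roots form the unique maximal order.
`D` carries it into `Λ`; conversely, if `p` divides a difference of two roots, the values of an
element of `Λ` there agree modulo `p`, which excludes an idempotent from `Λ_p`. -/

lemma dirichletMonomial_eq_ofPowerSeries {p : ℕ} (hp : 1 < p) :
    dirichletMonomial p = ArithmeticFunction.ofPowerSeries p PowerSeries.X := by
  ext n
  rw [ArithmeticFunction.ofPowerSeries_apply hp]
  by_cases h : ∃ k, p ^ k = n
  · obtain ⟨k, rfl⟩ := h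
    rw [(Nat.pow_right_injective hp).extend_apply, PowerSeries.coeff_X]
    have : (p ^ k ≠ 0 ∧ p ^ k = p) ↔ k = 1 := by
      constructor
      · rintro ⟨-, h⟩
        exact Nat.pow_right_injective hp (by simpa using h)
      · rintro rfl
        exact ⟨by simp; omega, by simp⟩
    simp only [dirichletMonomial, ArithmeticFunction.coe_mk, this]
  · rw [Function.extend_apply' _ _ _ h]
    have : ¬ (n ≠ 0 ∧ n = p) := fun hn => h ⟨1, by simp [hn.2]⟩
    simp only [dirichletMonomial, ArithmeticFunction.coe_mk, if_neg this, Pi.zero_apply]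

/-- The Euler factor at `p` of a formal Dirichlet series as a power series in `p^{-s}`. -/
def eulerSeries (p : ℕ) (f : ArithmeticFunction ℤ) : PowerSeries ℤ :=
  PowerSeries.mk fun k => f (p ^ k)

@[simp] lemma coeff_eulerSeries (p k : ℕ) (f : ArithmeticFunction ℤ) :
    (eulerSeries p f).coeff k = f (p ^ k) := PowerSeries.coeff_mk _ _

lemma eulerFactor_eq_ofPowerSeries {p : ℕ} (hp : 1 < p) (f : ArithmeticFunction ℤ) :
    eulerFactor p f = ArithmeticFunction.ofPowerSeries p (eulerSeries p f) := by
  ext n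
  rw [ArithmeticFunction.ofPowerSeries_apply hp]
  by_cases h : ∃ k, p ^ k = n
  · obtain ⟨k, rfl⟩ := h
    rw [(Nat.pow_right_injective hp).extend_apply]
    simp [eulerFactor]
  · rw [Function.extend_apply' _ _ _ h]
    have h' : ¬ ∃ k, n = p ^ k := fun ⟨k, hk⟩ => h ⟨k, hk.symm⟩
    simp only [eulerFactor, ArithmeticFunction.coe_mk, if_neg h', Pi.zero_apply]

lemma eulerSeries_ofPowerSeries {p : ℕ} (hp : 1 < p) (g : PowerSeries ℤ) :
    eulerSeries p (ArithmeticFunction.ofPowerSeries p g) = g := by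
  ext k
  rw [coeff_eulerSeries, ArithmeticFunction.ofPowerSeries_apply_pow hp]

/-- The only common power of two distinct primes is `1`, so only the constant term survives. -/
lemma eulerSeries_ofPowerSeries_of_ne {p q : ℕ} (hp : p.Prime) (hq : q.Prime) (hpq : p ≠ q)
    (g : PowerSeries ℤ) :
    eulerSeries p (ArithmeticFunction.ofPowerSeries q g) =
      PowerSeries.C (PowerSeries.constantCoeff g) := by
  ext k
  rw [coeff_eulerSeries, PowerSeries.coeff_C]
  split_ifs with hk
  · simp [hk]
  · rw [ArithmeticFunction.ofPowerSeries_apply hq.one_lt, Function.extend_apply']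
    · rfl
    · rintro ⟨j, hj⟩
      have h1 : p ∣ q ^ j := hj ▸ dvd_pow_self p hk
      exact hpq ((Nat.prime_dvd_prime_iff_eq hp hq).1 (hp.dvd_of_dvd_pow h1))

/-- The divisors of `p^k` are the `p^i` with `i ≤ k`, so Dirichlet convolution becomes the Cauchy
product. -/
lemma eulerSeries_mul {p : ℕ} (hp : p.Prime) (f g : ArithmeticFunction ℤ) :
    eulerSeries p (f * g) = eulerSeries p f * eulerSeries p g := by
  ext k
  rw [coeff_eulerSeries, ArithmeticFunction.mul_apply, PowerSeries.coeff_mul,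
    Nat.sum_divisorsAntidiagonal (fun a b => f a * g b), Nat.sum_divisors_prime_pow hp,
    Finset.Nat.sum_antidiagonal_eq_sum_range_succ_mk]
  refine Finset.sum_congr rfl fun i hi => ?_
  rw [coeff_eulerSeries, coeff_eulerSeries, Nat.pow_div (by simpa [Nat.lt_succ_iff] using hi) hp.pos]

lemma eulerSeries_one {p : ℕ} (hp : 1 < p) : eulerSeries p 1 = 1 := by
  rw [← map_one (ArithmeticFunction.ofPowerSeries p), eulerSeries_ofPowerSeries hp]

lemma eulerSeries_pow {p : ℕ} (hp : p.Prime) (f : ArithmeticFunction ℤ) (n : ℕ) :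
    eulerSeries p (f ^ n) = eulerSeries p f ^ n := by
  induction n with
  | zero => simp [eulerSeries_one hp.one_lt]
  | succ n ih => rw [pow_succ, pow_succ, eulerSeries_mul hp, ih]

lemma eulerSeries_prod {p : ℕ} (hp : p.Prime) {ι : Type*} (s : Finset ι)
    (f : ι → ArithmeticFunction ℤ) :
    eulerSeries p (∏ i ∈ s, f i) = ∏ i ∈ s, eulerSeries p (f i) := by
  classical
  induction s using Finset.induction_on with
  | empty => simp [eulerSeries_one hp.one_lt]
  | insert a s ha ih => rw [Finset.prod_insert ha, Finset.prod_insert ha, eulerSeries_mul hp, ih]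

lemma eulerSeries_zeta_mul {p : ℕ} (hp : p.Prime) :
    eulerSeries p (ArithmeticFunction.zeta : ArithmeticFunction ℤ) * (1 - PowerSeries.X) = 1 := by
  have : eulerSeries p (ArithmeticFunction.zeta : ArithmeticFunction ℤ) = PowerSeries.mk 1 := by
    ext k
    simp [ArithmeticFunction.zeta_apply, hp.ne_zero]
  rw [this, PowerSeries.mk_one_mul_one_sub_eq_one]

lemma aeval_dirichletMonomial {p : ℕ} (hp : 1 < p) (δ : ℤ[X]) :
    aeval (dirichletMonomial p) δ =
      ArithmeticFunction.ofPowerSeries p (δ : PowerSeries ℤ) := by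
  rw [dirichletMonomial_eq_ofPowerSeries hp, aeval_algHom_apply]
  congr 1
  induction δ using Polynomial.induction_on' with
  | add a b ha hb => simp [ha, hb]
  | monomial n a =>
    rw [aeval_monomial, Polynomial.coe_monomial, PowerSeries.monomial_eq_C_mul_X_pow]
    simp

lemma eulerFactor_zeta_pow_mul {p : ℕ} (hp : p.Prime) (n : ℕ) :
    eulerFactor p ((ArithmeticFunction.zeta : ArithmeticFunction ℤ) ^ n) *
      (1 - dirichletMonomial p) ^ n = 1 := by
  rw [eulerFactor_eq_ofPowerSeries hp.one_lt, dirichletMonomial_eq_ofPowerSeries hp.one_lt,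
    ← map_one (ArithmeticFunction.ofPowerSeries p), ← map_sub, ← map_pow, ← map_mul,
    eulerSeries_pow hp, ← mul_pow, eulerSeries_zeta_mul hp, one_pow]

/-- A series supported on the powers of `p` is determined by its Euler factor at `p`. -/
lemma eq_ofPowerSeries_eulerSeries {p : ℕ} (hp : 1 < p) (f : ArithmeticFunction ℤ)
    (h : ∀ n, f n ≠ 0 → ∃ k, n = p ^ k) :
    f = ArithmeticFunction.ofPowerSeries p (eulerSeries p f) := by
  rw [← eulerFactor_eq_ofPowerSeries hp]
  ext n
  simp only [eulerFactor, ArithmeticFunction.coe_mk]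
  split_ifs with hn
  · rfl
  · by_contra h0
    exact hn (h n h0)

/-- The Euler product of a multiplicative series almost all of whose Euler factors are those
of `ζ(s)^m`. -/
theorem eq_prod_aeval_mul_zeta_pow (F : ArithmeticFunction ℤ) (hF : F.IsMultiplicative)
    (m N : ℕ) (δ : ℕ → ℤ[X])
    (hδ : ∀ p : ℕ, p.Prime →
      (δ p : PowerSeries ℤ) = eulerSeries p F * (1 - PowerSeries.X) ^ m)
    (hN : ∀ p : ℕ, p.Prime → p ∉ N.primeFactors →
      eulerSeries p F * (1 - PowerSeries.X) ^ m = 1) :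
    F = (∏ p ∈ N.primeFactors, aeval (dirichletMonomial p) (δ p)) *
      (ArithmeticFunction.zeta : ArithmeticFunction ℤ) ^ m := by
  have hprime : ∀ p ∈ N.primeFactors, p.Prime := fun p hp => Nat.prime_of_mem_primeFactors hp
  have hconst : ∀ p ∈ N.primeFactors, PowerSeries.constantCoeff (δ p : PowerSeries ℤ) = 1 := by
    intro p hp
    rw [hδ p (hprime p hp)]
    have h1 : PowerSeries.constantCoeff (eulerSeries p F) = 1 := by
      rw [← PowerSeries.coeff_zero_eq_constantCoeff_apply, coeff_eulerSeries, pow_zero, hF.map_one]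
    simp [h1]
  have hprod : ArithmeticFunction.IsMultiplicative
      (∏ p ∈ N.primeFactors, aeval (dirichletMonomial p) (δ p)) := by
    refine ArithmeticFunction.isMultiplicative_finsetProd _ _ fun p hp => ?_
    rw [aeval_dirichletMonomial (hprime p hp).one_lt]
    exact ArithmeticFunction.isMultiplicative_ofPowerSeries_of_isPrimePow p
      (hprime p hp).isPrimePow _ (hconst p hp)
  have hzeta : ArithmeticFunction.IsMultiplicative
      ((ArithmeticFunction.zeta : ArithmeticFunction ℤ) ^ m) :=
    (ArithmeticFunction.isMultiplicative_zeta.natCast).pow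
  -- Both sides are multiplicative, so it suffices to compare Euler factors; the factors belonging
  -- to primes `q ≠ p` contribute only their constant term `1`.
  rw [hF.eq_iff_eq_on_prime_powers _ _ (hprod.mul hzeta)]
  intro p i hp
  rw [← coeff_eulerSeries, ← coeff_eulerSeries]
  congr 1
  rw [eulerSeries_mul hp, eulerSeries_prod hp, eulerSeries_pow hp]
  have hz : eulerSeries p (ArithmeticFunction.zeta : ArithmeticFunction ℤ) ^ m *
      (1 - PowerSeries.X) ^ m = 1 := by
    rw [← mul_pow, eulerSeries_zeta_mul hp, one_pow]
  have hfac : ∀ q ∈ N.primeFactors, eulerSeries p (aeval (dirichletMonomial q) (δ q)) =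
      if q = p then eulerSeries p F * (1 - PowerSeries.X) ^ m else 1 := by
    intro q hq
    rw [aeval_dirichletMonomial (hprime q hq).one_lt]
    split_ifs with h
    · subst h
      rw [eulerSeries_ofPowerSeries hp.one_lt, hδ q hp]
    · rw [eulerSeries_ofPowerSeries_of_ne hp (hprime q hq) (Ne.symm h), hconst q hq, map_one]
  rw [Finset.prod_congr rfl hfac, Finset.prod_ite_eq']
  split_ifs with h
  · rw [mul_assoc, mul_comm ((1 - PowerSeries.X) ^ m), hz, mul_one]
  · rw [one_mul]
    calc _ = eulerSeries p F * (eulerSeries p (ArithmeticFunction.zeta : ArithmeticFunction ℤ) ^ m *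
      (1 - PowerSeries.X) ^ m) := by rw [hz, mul_one]
      _ = eulerSeries p F * (1 - PowerSeries.X) ^ m *
        eulerSeries p (ArithmeticFunction.zeta : ArithmeticFunction ℤ) ^ m := by ring
      _ = _ := by rw [hN p hp h, one_mul]

/-! ### Passage to functions of a complex variable -/

/-- The Dirichlet series of `f` converges absolutely at `s`, with sum `z`. -/
def HasLValue (s : ℂ) (f : ArithmeticFunction ℤ) (z : ℂ) : Prop :=
  LSeriesHasSum (fun n => ((f n : ℤ) : ℂ)) s z

lemma HasLValue.mul {s : ℂ} {f g : ArithmeticFunction ℤ} {y z : ℂ} (hf : HasLValue s f y)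
    (hg : HasLValue s g z) : HasLValue s (f * g) (y * z) := by
  have := ArithmeticFunction.LSeriesHasSum_mul (f := (f : ArithmeticFunction ℂ))
    (g := (g : ArithmeticFunction ℂ)) hf hg
  rw [← ArithmeticFunction.intCoe_mul] at this
  exact this

lemma HasLValue.add {s : ℂ} {f g : ArithmeticFunction ℤ} {y z : ℂ} (hf : HasLValue s f y)
    (hg : HasLValue s g z) : HasLValue s (f + g) (y + z) := by
  have h := LSeriesHasSum.add hf hg
  have he : (fun n => (((f + g) n : ℤ) : ℂ)) =
      (fun n => ((f n : ℤ) : ℂ)) + fun n => ((g n : ℤ) : ℂ) := by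
    ext n
    simp
  rwa [HasLValue, he]

lemma HasLValue.intSmul {s : ℂ} {f : ArithmeticFunction ℤ} {z : ℂ} (a : ℤ)
    (hf : HasLValue s f z) : HasLValue s (a • f) (a • z) := by
  have h := LSeriesHasSum.smul (a : ℂ) hf
  -- Evaluation at `n` is additive, hence compatible with integer multiples.
  let ev (n : ℕ) : ArithmeticFunction ℤ →+ ℤ := ⟨⟨fun g => g n, rfl⟩, fun _ _ => rfl⟩
  have he : (fun n => (((a • f) n : ℤ) : ℂ)) = (a : ℂ) • fun n => ((f n : ℤ) : ℂ) := by
    ext n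
    have h1 : (a • f) n = a * f n := (map_zsmul (ev n) a f).trans (zsmul_eq_mul _ _)
    rw [h1]
    simp
  rwa [HasLValue, he, zsmul_eq_mul]

lemma HasLValue.dirichletMonomial (s : ℂ) {p : ℕ} (hp : p ≠ 0) :
    HasLValue s (dirichletMonomial p) ((p : ℂ) ^ (-s)) := by
  unfold HasLValue LSeriesHasSum
  convert hasSum_single p ?_ using 1
  · simp [IdealZeta.dirichletMonomial, hp, Complex.cpow_neg]
  · intro n hn
    rcases eq_or_ne n 0 with rfl | h0
    · simp
    · simp [LSeries.term_of_ne_zero h0, IdealZeta.dirichletMonomial, hn]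

lemma HasLValue.one (s : ℂ) : HasLValue s 1 1 := by
  have h := HasLValue.dirichletMonomial s one_ne_zero
  have he : IdealZeta.dirichletMonomial 1 = 1 := by
    ext n
    simp only [IdealZeta.dirichletMonomial, ArithmeticFunction.coe_mk,
      ArithmeticFunction.one_apply]
    congr 1
    exact propext ⟨fun h => h.2, fun h => ⟨by simp [h], h⟩⟩
  simpa [he] using h

lemma HasLValue.pow {s : ℂ} {f : ArithmeticFunction ℤ} {z : ℂ} (hf : HasLValue s f z) (n : ℕ) :
    HasLValue s (f ^ n) (z ^ n) := by
  induction n with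
  | zero => simpa using HasLValue.one s
  | succ n ih => simpa [pow_succ] using ih.mul hf

lemma HasLValue.prod {s : ℂ} {ι : Type*} (t : Finset ι) {f : ι → ArithmeticFunction ℤ}
    {z : ι → ℂ} (hf : ∀ i ∈ t, HasLValue s (f i) (z i)) :
    HasLValue s (∏ i ∈ t, f i) (∏ i ∈ t, z i) := by
  classical
  induction t using Finset.induction_on with
  | empty => simpa using HasLValue.one s
  | insert a t ha ih =>
    rw [Finset.prod_insert ha, Finset.prod_insert ha]
    exact (hf a (Finset.mem_insert_self a t)).mul
      (ih fun i hi => hf i (Finset.mem_insert_of_mem hi))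

lemma HasLValue.aeval {s : ℂ} {f : ArithmeticFunction ℤ} {z : ℂ} (hf : HasLValue s f z)
    (δ : ℤ[X]) : HasLValue s (Polynomial.aeval f δ) (Polynomial.aeval z δ) := by
  induction δ using Polynomial.induction_on' with
  | add a b ha hb => simpa using ha.add hb
  | monomial n a =>
    rw [aeval_monomial, aeval_monomial, eq_intCast, eq_intCast, ← zsmul_eq_mul, ← zsmul_eq_mul]
    exact (hf.pow n).intSmul a

lemma HasLValue.zeta {s : ℂ} (hs : 1 < s.re) :
    HasLValue s (ArithmeticFunction.zeta : ArithmeticFunction ℤ) (riemannZeta s) := by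
  have h := ArithmeticFunction.LSeriesHasSum_zeta hs
  have he : (fun n => (((ArithmeticFunction.zeta : ArithmeticFunction ℤ) n : ℤ) : ℂ)) =
      fun n => ((ArithmeticFunction.zeta n : ℕ) : ℂ) := by
    ext n
    rw [ArithmeticFunction.natCoe_apply]
    norm_cast
  rwa [HasLValue, he]

/-! ### Ideals of finite index -/

/-- Cauchy's theorem in the finite group `M / H`. -/
lemma exists_nsmul_mem_of_dvd_index {M : Type*} [AddCommGroup M] {H : AddSubgroup M}
    (h0 : H.index ≠ 0) {q : ℕ} (hq : q.Prime) (hqH : q ∣ H.index) : ∃ y ∉ H, q • y ∈ H := by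
  have hq' : Fact q.Prime := ⟨hq⟩
  have : Finite (M ⧸ H) := AddSubgroup.fintypeOfIndexNeZero h0 |>.finite
  obtain ⟨x, hx⟩ := exists_prime_addOrderOf_dvd_card' (G := M ⧸ H) q hqH
  obtain ⟨y, rfl⟩ := QuotientAddGroup.mk_surjective x
  refine ⟨y, fun hy => ?_, ?_⟩
  · rw [(QuotientAddGroup.eq_zero_iff y).2 hy, addOrderOf_zero] at hx
    exact hq.one_lt.ne hx
  · rw [← QuotientAddGroup.eq_zero_iff, QuotientAddGroup.mk_nsmul, ← hx,
      addOrderOf_nsmul_eq_zero]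

/-- If all primes other than `p` are invertible on `M / H`, the index of `H` is a power of `p`. -/
lemma exists_index_eq_pow {M : Type*} [AddCommGroup M] {H : AddSubgroup M} {p : ℕ}
    (h0 : H.index ≠ 0) (h : ∀ q : ℕ, q.Prime → q ≠ p → ∀ y, q • y ∈ H → y ∈ H) :
    ∃ k, H.index = p ^ k := by
  refine ⟨_, Nat.eq_prime_pow_of_unique_prime_dvd h0 fun {q} hq hqI => ?_⟩
  by_contra hqp
  obtain ⟨y, hy, hqy⟩ := exists_nsmul_mem_of_dvd_index h0 hq hqI
  exact hy (h q hq hqp y hqy)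

/-- The index annihilates the quotient group, in particular the class of `1`. Hence the ideals of
index `n` can be counted in `R / n`. -/
lemma natCast_mem_of_mem_idealsOfIndex {R : Type*} [Ring R] {n : ℕ} {I : Ideal R}
    (hI : I ∈ idealsOfIndex R n) : (n : R) ∈ I := by
  have := AddSubgroup.nsmul_index_mem (Submodule.toAddSubgroup I) (1 : R)
  rw [show (Submodule.toAddSubgroup I).index = n from hI] at this
  simpa using this

lemma idealIndex_comap {R Q : Type*} [Ring R] [Ring Q] {q : R →+* Q}
    (hq : Function.Surjective q) (I : Ideal Q) : idealIndex (I.comap q) = idealIndex I :=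
  AddSubgroup.index_comap_of_surjective (f := (q : R →+ Q)) (Submodule.toAddSubgroup I) hq

lemma idealsOfIndex_eq_image_comap {R Q : Type*} [Ring R] [Ring Q] {q : R →+* Q}
    (hq : Function.Surjective q) {n : ℕ}
    (hker : ∀ I ∈ idealsOfIndex R n, ∀ x, q x = 0 → x ∈ I) :
    idealsOfIndex R n = Ideal.comap q '' idealsOfIndex Q n := by
  ext I
  constructor
  · intro hI
    have h : (I.map q).comap q = I := by
      rw [Ideal.comap_map_of_surjective q hq]
      refine sup_eq_left.2 fun x hx => hker I hI x (by simpa using hx)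
    refine ⟨I.map q, ?_, h⟩
    change idealIndex _ = n
    rw [← idealIndex_comap hq, h]
    exact hI
  · rintro ⟨J, hJ, rfl⟩
    exact (idealIndex_comap hq J).trans hJ

lemma ncard_idealsOfIndex_of_surjective {R Q : Type*} [Ring R] [Ring Q] {q : R →+* Q}
    (hq : Function.Surjective q) {n : ℕ}
    (hker : ∀ I ∈ idealsOfIndex R n, ∀ x, q x = 0 → x ∈ I) :
    (idealsOfIndex R n).ncard = (idealsOfIndex Q n).ncard := by
  rw [idealsOfIndex_eq_image_comap hq hker]
  exact Set.ncard_image_of_injective _ (Ideal.comap_injective_of_surjective q hq)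

lemma finite_idealsOfIndex_of_surjective {R Q : Type*} [Ring R] [Ring Q] {q : R →+* Q}
    (hq : Function.Surjective q) {n : ℕ} (h : (idealsOfIndex R n).Finite) :
    (idealsOfIndex Q n).Finite := by
  refine Set.Finite.of_finite_image (f := Ideal.comap q) (h.subset ?_)
    (Ideal.comap_injective_of_surjective q hq).injOn
  rintro _ ⟨J, hJ, rfl⟩
  exact (idealIndex_comap hq J).trans hJ

lemma ncard_idealsOfIndex_congr {R Q : Type*} [Ring R] [Ring Q] (e : R ≃+* Q) (n : ℕ) :
    (idealsOfIndex R n).ncard = (idealsOfIndex Q n).ncard :=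
  ncard_idealsOfIndex_of_surjective (q := (e : R →+* Q)) e.surjective fun I _ x hx => by
    have : x = 0 := by simpa using hx
    simp [this]

lemma ringZeta_congr {R Q : Type*} [Ring R] [Ring Q] (e : R ≃+* Q) : ringZeta R = ringZeta Q := by
  ext n
  simp [ringZeta, ncard_idealsOfIndex_congr e n]

lemma ringZeta_apply {R : Type*} [Ring R] {n : ℕ} (hn : n ≠ 0) :
    ringZeta R n = (idealsOfIndex R n).ncard := by
  simp [ringZeta, hn]

/-- The quotients `R / n` and `R' / n` have the same ideals when `R → R'` becomes an isomorphism
modulo `n`. -/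
lemma ncard_idealsOfIndex_eq_of_mod {R R' : Type*} [CommRing R] [CommRing R'] (φ : R →+* R')
    {n : ℕ} (hsurj : ∀ y : R', ∃ x : R, ∃ z : R', y = φ x + n * z)
    (hinj : ∀ x : R, ∀ z : R', φ x = n * z → ∃ w : R, x = n * w) :
    (idealsOfIndex R n).ncard = (idealsOfIndex R' n).ncard := by
  let q' := Ideal.Quotient.mk (Ideal.span {(n : R')})
  have hq' : Function.Surjective q' := Ideal.Quotient.mk_surjective
  have hzero : ∀ y, q' y = 0 ↔ ∃ z, y = n * z := fun y => by
    rw [Ideal.Quotient.eq_zero_iff_mem, Ideal.mem_span_singleton, dvd_def]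
  have hn : q' (n : R') = 0 := (hzero _).2 ⟨1, by simp⟩
  have hcomp : Function.Surjective (q'.comp φ) := by
    intro y
    obtain ⟨y, rfl⟩ := hq' y
    obtain ⟨x, z, rfl⟩ := hsurj y
    exact ⟨x, by simp [hn, -map_natCast]⟩
  -- Both rings map onto `R' / n`. By `hinj` the kernel of `R → R' / n` lies in `nR`, so on either
  -- side an ideal of index `n` contains the kernel.
  rw [ncard_idealsOfIndex_of_surjective hcomp, ← ncard_idealsOfIndex_of_surjective hq']
  · intro I hI x hx
    obtain ⟨z, rfl⟩ := (hzero x).1 hx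
    exact I.mul_mem_right _ (natCast_mem_of_mem_idealsOfIndex hI)
  · intro I hI x hx
    obtain ⟨z, hz⟩ := (hzero _).1 hx
    obtain ⟨w, rfl⟩ := hinj x z hz
    exact I.mul_mem_right _ (natCast_mem_of_mem_idealsOfIndex hI)

/-- For finiteness, surjectivity modulo `n` is enough: ideals of `R' / n` pull back injectively to
`R`. -/
lemma finite_idealsOfIndex_of_mod {R R' : Type*} [CommRing R] [CommRing R'] (φ : R →+* R')
    {n : ℕ} (hsurj : ∀ y : R', ∃ x : R, ∃ z : R', y = φ x + n * z)
    (h : (idealsOfIndex R n).Finite) : (idealsOfIndex R' n).Finite := by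
  let q' := Ideal.Quotient.mk (Ideal.span {(n : R')})
  have hq' : Function.Surjective q' := Ideal.Quotient.mk_surjective
  have hn : q' (n : R') = 0 := Ideal.Quotient.eq_zero_iff_mem.2 (Ideal.mem_span_singleton_self _)
  have hcomp : Function.Surjective (q'.comp φ) := by
    intro y
    obtain ⟨y, rfl⟩ := hq' y
    obtain ⟨x, z, rfl⟩ := hsurj y
    exact ⟨x, by simp [hn, -map_natCast]⟩
  rw [idealsOfIndex_eq_image_comap hq']
  · exact (finite_idealsOfIndex_of_surjective hcomp h).image _
  · intro I hI x hx
    obtain ⟨z, rfl⟩ := Ideal.mem_span_singleton.1 (Ideal.Quotient.eq_zero_iff_mem.1 hx)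
    exact I.mul_mem_right _ (natCast_mem_of_mem_idealsOfIndex hI)

/-- A ring that is a finitely generated abelian group has finitely many ideals of given index. -/
lemma finite_idealsOfIndex_of_finite (R : Type*) [CommRing R] [Module.Finite ℤ R] {n : ℕ}
    (hn : n ≠ 0) : (idealsOfIndex R n).Finite := by
  let q := Ideal.Quotient.mk (Ideal.span {(n : R)})
  have hfin : Finite (R ⧸ Ideal.span {(n : R)}) := by
    have : Module.Finite ℤ (R ⧸ Ideal.span {(n : R)}) :=
      Module.Finite.of_surjective
        ((Ideal.Quotient.mkₐ ℤ (Ideal.span {(n : R)})).toLinearMap) Ideal.Quotient.mk_surjective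
    -- The quotient is a finitely generated abelian group killed by `n`, hence finite.
    refine Module.finite_of_fg_torsion _ fun x => ?_
    obtain ⟨x, rfl⟩ := Ideal.Quotient.mk_surjective x
    refine ⟨⟨n, by simpa using hn⟩, ?_⟩
    change ((n : ℤ) • q x) = 0
    rw [zsmul_eq_mul, Int.cast_natCast, ← map_natCast q, ← map_mul]
    exact Ideal.Quotient.eq_zero_iff_mem.2 (Ideal.mul_mem_right _ _ (Ideal.mem_span_singleton_self _))
  rw [idealsOfIndex_eq_image_comap (q := q) Ideal.Quotient.mk_surjective]
  · exact Set.Finite.image _ (Set.toFinite _)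
  · intro I hI x hx
    obtain ⟨z, rfl⟩ := Ideal.mem_span_singleton.1 (Ideal.Quotient.eq_zero_iff_mem.1 hx)
    exact I.mul_mem_right _ (natCast_mem_of_mem_idealsOfIndex hI)

/-! ### Ideals of a product of two rings. -/

lemma idealIndex_prod {R S : Type*} [Ring R] [Ring S] (I : Ideal R) (J : Ideal S) :
    idealIndex (I.prod J) = idealIndex I * idealIndex J :=
  (AddSubgroup.index_prod (Submodule.toAddSubgroup I) (Submodule.toAddSubgroup J))

lemma idealsOfIndex_prod {R S : Type*} [Ring R] [Ring S] {n : ℕ} (hn : n ≠ 0) :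
    idealsOfIndex (R × S) n = ⋃ d ∈ (n.divisorsAntidiagonal : Set (ℕ × ℕ)),
      (Ideal.idealProdEquiv (R := R) (S := S)).symm ''
        (idealsOfIndex R d.1 ×ˢ idealsOfIndex S d.2) := by
  ext I
  obtain ⟨⟨J, K⟩, rfl⟩ := (Ideal.idealProdEquiv (R := R) (S := S)).symm.surjective I
  simp only [Set.mem_iUnion, exists_prop, EquivLike.apply_eq_iff_eq, Set.mem_image,
    exists_eq_right, Set.mem_prod, Finset.mem_coe]
  constructor
  · intro h
    refine ⟨(idealIndex J, idealIndex K), ?_, rfl, rfl⟩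
    rw [Nat.mem_divisorsAntidiagonal]
    exact ⟨(idealIndex_prod J K).symm.trans h, hn⟩
  · rintro ⟨⟨a, b⟩, hd, hJ, hK⟩
    rw [Nat.mem_divisorsAntidiagonal] at hd
    refine (idealIndex_prod J K).trans ?_
    rw [← hd.1, show idealIndex J = a from hJ, show idealIndex K = b from hK]

lemma finite_prod_idealsOfIndex {R S : Type*} [Ring R] [Ring S] {n : ℕ}
    (hR : ∀ d, d ≠ 0 → (idealsOfIndex R d).Finite)
    (hS : ∀ d, d ≠ 0 → (idealsOfIndex S d).Finite) :
    ∀ d ∈ (n.divisorsAntidiagonal : Set (ℕ × ℕ)),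
      ((Ideal.idealProdEquiv (R := R) (S := S)).symm ''
        (idealsOfIndex R d.1 ×ˢ idealsOfIndex S d.2)).Finite := by
  intro d hd
  rw [Finset.mem_coe, Nat.mem_divisorsAntidiagonal] at hd
  refine ((hR _ ?_).prod (hS _ ?_)).image _
  · rintro h; exact hd.2 (by rw [← hd.1, h, zero_mul])
  · rintro h; exact hd.2 (by rw [← hd.1, h, mul_zero])

lemma finite_idealsOfIndex_prod {R S : Type*} [Ring R] [Ring S]
    (hR : ∀ d, d ≠ 0 → (idealsOfIndex R d).Finite)
    (hS : ∀ d, d ≠ 0 → (idealsOfIndex S d).Finite) {n : ℕ} (hn : n ≠ 0) :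
    (idealsOfIndex (R × S) n).Finite := by
  rw [idealsOfIndex_prod hn]
  exact (Finset.finite_toSet _).biUnion (finite_prod_idealsOfIndex hR hS)

lemma ringZeta_prod {R S : Type*} [Ring R] [Ring S]
    (hR : ∀ d, d ≠ 0 → (idealsOfIndex R d).Finite)
    (hS : ∀ d, d ≠ 0 → (idealsOfIndex S d).Finite) :
    ringZeta (R × S) = ringZeta R * ringZeta S := by
  ext n
  rcases eq_or_ne n 0 with rfl | hn
  · simp
  have hd0 : ∀ d ∈ n.divisorsAntidiagonal, d.1 ≠ 0 ∧ d.2 ≠ 0 := by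
    intro d hd
    rw [Nat.mem_divisorsAntidiagonal] at hd
    exact mul_ne_zero_iff.1 (hd.1 ▸ hd.2)
  rw [ringZeta_apply hn, idealsOfIndex_prod hn, Set.Finite.ncard_biUnion (Finset.finite_toSet _)
    (finite_prod_idealsOfIndex hR hS), finsum_mem_coe_finset, ArithmeticFunction.mul_apply]
  · push_cast
    refine Finset.sum_congr rfl fun d hd => ?_
    rw [ringZeta_apply (hd0 d hd).1, ringZeta_apply (hd0 d hd).2,
      Set.ncard_image_of_injective _ (OrderIso.injective _), Set.ncard_prod]
    push_cast
    rfl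
  · intro d hd e he hde
    rw [Function.onFun, Set.disjoint_left]
    rintro _ ⟨⟨J, K⟩, ⟨hJ, hK⟩, rfl⟩ ⟨⟨J', K'⟩, ⟨hJ', hK'⟩, h⟩
    obtain ⟨rfl, rfl⟩ := Prod.mk.inj ((OrderIso.injective _) h)
    exact hde (Prod.ext (hJ.symm.trans hJ') (hK.symm.trans hK'))

/-- The index of an ideal containing `n` has only prime divisors of `n`. -/
lemma idealIndex_coprime {R : Type*} [Ring R] {I : Ideal R} {n m : ℕ} (hn : (n : R) ∈ I)
    (h0 : idealIndex I ≠ 0) (hnm : n.Coprime m) : (idealIndex I).Coprime m := by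
  refine Nat.coprime_of_dvd fun q hq hqI hqm => ?_
  obtain ⟨y, hy, hqy⟩ := exists_nsmul_mem_of_dvd_index h0 hq hqI
  -- Both `q * y` and `n * y` lie in `I`, so a Bézout relation puts `y` in `I`, a contradiction.
  have hqn : IsCoprime (q : ℤ) n := (hnm.coprime_dvd_right hqm).symm.isCoprime
  obtain ⟨u, w, huw⟩ := hqn
  refine hy ?_
  have hqy' : (q : R) * y ∈ I := by rwa [← nsmul_eq_mul]
  have hny : (n : R) * y ∈ I := by rw [Nat.cast_comm]; exact I.mul_mem_left y hn
  have h := congrArg (Int.cast : ℤ → R) huw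
  push_cast at h
  have : y = (u : R) * (q * y) + w * (n * y) := by
    rw [← mul_assoc, ← mul_assoc, ← add_mul, h, one_mul]
  change y ∈ I
  rw [this]
  exact I.add_mem (I.mul_mem_left _ hqy') (I.mul_mem_left _ hny)

/-- The zeta function of a ring with finitely many ideals of each index is multiplicative. -/
theorem isMultiplicative_ringZeta {R : Type*} [CommRing R]
    (hR : ∀ n, n ≠ 0 → (idealsOfIndex R n).Finite) : (ringZeta R).IsMultiplicative := by
  refine ArithmeticFunction.IsMultiplicative.iff_ne_zero.2 ⟨?_, ?_⟩
  · have : idealsOfIndex R 1 = {⊤} := by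
      ext I
      simp only [idealsOfIndex, idealIndex, Set.mem_ofPred_eq, AddSubgroup.index_eq_one,
        Set.mem_singleton_iff]
      exact Submodule.toAddSubgroup_injective.eq_iff' rfl
    simp [ringZeta_apply one_ne_zero, this]
  intro m n hm hn hmn
  let I := Ideal.span {(m : R)}
  let J := Ideal.span {(n : R)}
  have hIJ : IsCoprime I J := by
    rw [Ideal.isCoprime_span_singleton_iff]
    simpa using hmn.isCoprime.map (Int.castRingHom R)
  have hquot : ∀ K : Ideal R, ∀ d, d ≠ 0 → (idealsOfIndex (R ⧸ K) d).Finite := fun K d hd =>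
    finite_idealsOfIndex_of_surjective (q := Ideal.Quotient.mk K) Ideal.Quotient.mk_surjective
      (hR d hd)
  have hspan : ∀ k, ringZeta R k = ringZeta (R ⧸ Ideal.span {(k : R)}) k := by
    intro k
    rcases eq_or_ne k 0 with rfl | hk
    · simp
    rw [ringZeta_apply hk, ringZeta_apply hk, ncard_idealsOfIndex_of_surjective
      (q := Ideal.Quotient.mk (Ideal.span {(k : R)})) Ideal.Quotient.mk_surjective]
    intro I hI x hx
    obtain ⟨z, rfl⟩ := Ideal.mem_span_singleton.1 (Ideal.Quotient.eq_zero_iff_mem.1 hx)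
    exact I.mul_mem_right _ (natCast_mem_of_mem_idealsOfIndex hI)
  -- The indices of ideals of `R / k` involve only primes dividing `k`. In the convolution for `R /
  -- m × R / n` this leaves only the term `(m, n)`.
  have hcop : ∀ k l d : ℕ, k.Coprime l → d ≠ 0 → ringZeta (R ⧸ Ideal.span {(k : R)}) d ≠ 0 →
      d.Coprime l := by
    intro k l d hkl hd h
    rw [ringZeta_apply hd] at h
    obtain ⟨K, hK⟩ := Set.nonempty_of_ncard_ne_zero (by exact_mod_cast h)
    have hk : ((k : ℕ) : R ⧸ Ideal.span {(k : R)}) ∈ K := by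
      rw [← map_natCast (Ideal.Quotient.mk (Ideal.span {(k : R)})),
        Ideal.Quotient.eq_zero_iff_mem.2 (Ideal.mem_span_singleton_self _)]
      exact K.zero_mem
    have hK' : idealIndex K = d := hK
    exact hK' ▸ idealIndex_coprime hk (hK'.symm ▸ hd) hkl
  have hmul : I * J = Ideal.span {((m * n : ℕ) : R)} := by
    simp [I, J, Ideal.span_singleton_mul_span_singleton]
  rw [hspan (m * n), ← hmul, ringZeta_congr (Ideal.quotientMulEquivQuotientProd I J hIJ),
    ringZeta_prod (hquot I) (hquot J), ArithmeticFunction.mul_apply, hspan m, hspan n,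
    Finset.sum_eq_single_of_mem (m, n) (by simp [hm, hn])]
  rintro ⟨a, b⟩ hab hne
  by_contra h
  obtain ⟨ha, hb⟩ := mul_ne_zero_iff.1 h
  rw [Nat.mem_divisorsAntidiagonal] at hab
  have hab0 := mul_ne_zero_iff.1 (hab.1 ▸ hab.2 : a * b ≠ 0)
  have h1 := hcop m n a hmn hab0.1 ha
  have h2 := hcop n m b hmn.symm hab0.2 hb
  have h3 : a = m := Nat.dvd_antisymm (h1.dvd_of_dvd_mul_right (hab.1 ▸ dvd_mul_right a b))
    (h2.symm.dvd_of_dvd_mul_right (hab.1 ▸ dvd_mul_right m n))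
  subst h3
  exact hne (Prod.ext rfl (Nat.eq_of_mul_eq_mul_left (Nat.pos_of_ne_zero hm) hab.1))

/-! ### Comparison of a ring with a localization at `p` -/

section Localization

variable {R R' : Type*} [CommRing R] [CommRing R'] (φ : R →+* R') {p : ℕ}

/-- A denominator `b` prime to `p` is invertible modulo `p^k`: if `u b + w p^k = 1`, then `y = u (b
y) + p^k (w y)`. -/
lemma exists_eq_map_add_pow_mul
    (hden : ∀ y : R', ∃ b : ℕ, b.Coprime p ∧ ∃ x : R, (b : R') * y = φ x) (k : ℕ) (y : R') :
    ∃ x : R, ∃ z : R', y = φ x + ((p ^ k : ℕ) : R') * z := by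
  obtain ⟨b, hb, x, hx⟩ := hden y
  obtain ⟨u, w, huw⟩ := (hb.pow_right k).isCoprime
  refine ⟨u * x, w * y, ?_⟩
  have h := congrArg (Int.cast : ℤ → R') huw
  push_cast at h ⊢
  rw [map_mul, map_intCast, ← hx]
  linear_combination -y * h

/-- Clearing the denominator of `z` gives `b x ∈ p^k R`, and `b` is invertible modulo `p^k`. -/
lemma exists_eq_pow_mul (hφ : Function.Injective φ)
    (hden : ∀ y : R', ∃ b : ℕ, b.Coprime p ∧ ∃ x : R, (b : R') * y = φ x) (k : ℕ) (x : R) (z : R')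
    (h : φ x = ((p ^ k : ℕ) : R') * z) : ∃ w : R, x = ((p ^ k : ℕ) : R) * w := by
  obtain ⟨b, hb, y, hy⟩ := hden z
  obtain ⟨u, w, huw⟩ := (hb.pow_right k).isCoprime
  have h1 : (b : R) * x = ((p ^ k : ℕ) : R) * y := hφ (by
    rw [map_mul, map_mul, h, ← hy, map_natCast, map_natCast]; ring)
  refine ⟨u * y + w * x, ?_⟩
  have h2 := congrArg (Int.cast : ℤ → R) huw
  push_cast at h1 h2 ⊢
  linear_combination u * h1 - x * h2

lemma ringZeta_prime_pow_eq (hp : p.Prime) (hφ : Function.Injective φ)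
    (hden : ∀ y : R', ∃ b : ℕ, b.Coprime p ∧ ∃ x : R, (b : R') * y = φ x) (k : ℕ) :
    ringZeta R (p ^ k) = ringZeta R' (p ^ k) := by
  rw [ringZeta_apply (pow_ne_zero k hp.ne_zero), ringZeta_apply (pow_ne_zero k hp.ne_zero),
    ncard_idealsOfIndex_eq_of_mod φ (exists_eq_map_add_pow_mul φ hden k)
      (exists_eq_pow_mul φ hφ hden k)]

end Localization

/-- If all primes other than `p` are invertible in `R`, the finite indices are powers of `p`. -/
lemma exists_idealIndex_eq_pow {R : Type*} [Ring R] {p : ℕ}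
    (hR : ∀ q : ℕ, q.Prime → q ≠ p → IsUnit (q : R)) (I : Ideal R) (h0 : idealIndex I ≠ 0) :
    ∃ k, idealIndex I = p ^ k := by
  refine exists_index_eq_pow h0 fun q hq hqp y hy => ?_
  obtain ⟨u, hu⟩ := hR q hq hqp
  have h : (u : R) * y ∈ I := by rwa [hu, ← nsmul_eq_mul]
  change y ∈ I
  simpa using I.mul_mem_left (↑u⁻¹ : R) h

lemma ringZeta_eq_zero_of_not_pow {R : Type*} [Ring R] {p : ℕ}
    (hR : ∀ q : ℕ, q.Prime → q ≠ p → IsUnit (q : R)) (n : ℕ) (h : ringZeta R n ≠ 0) :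
    ∃ k, n = p ^ k := by
  have hn : n ≠ 0 := fun h0 => h (by simp [h0])
  rw [ringZeta_apply hn] at h
  obtain ⟨I, hI⟩ := Set.nonempty_of_ncard_ne_zero (by exact_mod_cast h)
  have hI' : idealIndex I = n := hI
  exact hI' ▸ exists_idealIndex_eq_pow hR I (hI' ▸ hn)

/-! ### The ring `ℤ` -/

lemma idealIndex_span_int (n : ℤ) : idealIndex (Ideal.span {n}) = n.natAbs := by
  have h := Ideal.absNorm_span_singleton n
  rw [Algebra.norm_self, MonoidHom.id_apply] at h
  exact h

lemma ringZeta_int : ringZeta ℤ = (ArithmeticFunction.zeta : ArithmeticFunction ℤ) := by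
  ext n
  rcases eq_or_ne n 0 with rfl | hn
  · simp
  have h : idealsOfIndex ℤ n = {Ideal.span {(n : ℤ)}} := by
    ext I
    obtain ⟨m, rfl⟩ := (IsPrincipalIdealRing.principal I).principal
    simp only [idealsOfIndex, Set.mem_ofPred_eq, Set.mem_singleton_iff]
    rw [← Ideal.span, idealIndex_span_int, Ideal.span_singleton_eq_span_singleton,
      Int.associated_iff_natAbs, Int.natAbs_natCast]
  rw [ringZeta_apply hn, h]
  simp [ArithmeticFunction.zeta_apply, hn]

lemma finite_idealsOfIndex_int {n : ℕ} (hn : n ≠ 0) : (idealsOfIndex ℤ n).Finite :=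
  finite_idealsOfIndex_of_finite ℤ hn

/-! ### The localization of `ℤ` at `p` -/

section zLoc

variable {p : ℕ}

lemma zLoc_exists_den (y : zLoc p) :
    ∃ b : ℕ, b.Coprime p ∧ ∃ x : ℤ, (b : zLoc p) * y = Int.castRingHom (zLoc p) x :=
  ⟨y.1.den, y.2, y.1.num, Subtype.ext (by simp)⟩

lemma zLoc_isUnit_natCast (hp : p.Prime) {q : ℕ} (hq : q.Coprime p) : IsUnit (q : zLoc p) := by
  have hq0 : q ≠ 0 := by
    rintro rfl
    exact hp.one_lt.ne' (by simp at hq; exact hq)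
  have hmem : (q : ℚ)⁻¹ ∈ zLoc p := by
    change ((q : ℚ)⁻¹).den.Coprime p
    rwa [Rat.inv_natCast_den_of_pos (Nat.pos_of_ne_zero hq0)]
  refine IsUnit.of_mul_eq_one ⟨_, hmem⟩ (Subtype.ext ?_)
  have : (q : ℚ) ≠ 0 := by exact_mod_cast hq0
  simp [this]

lemma zLoc_isUnit_intCast (hp : p.Prime) {z : ℤ} (hz : ¬ (p : ℤ) ∣ z) : IsUnit (z : zLoc p) := by
  have h := zLoc_isUnit_natCast hp (q := z.natAbs)
    ((hp.coprime_iff_not_dvd.2 fun h => hz (Int.natCast_dvd.2 h)).symm)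
  rcases Int.natAbs_eq z with h' | h'
  · rw [h', Int.cast_natCast]; exact h
  · rw [h', Int.cast_neg, Int.cast_natCast]; exact h.neg

lemma zLoc_pow_dvd_intCast {k : ℕ} {z : ℤ} :
    (p : zLoc p) ^ k ∣ (z : zLoc p) ↔ (p : ℤ) ^ k ∣ z := by
  constructor
  · rintro ⟨y, hy⟩
    obtain ⟨w, hw⟩ := exists_eq_pow_mul (Int.castRingHom (zLoc p)) Int.cast_injective
      zLoc_exists_den k z y (by simpa using hy)
    exact ⟨w, by simpa using hw⟩
  · rintro ⟨w, rfl⟩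
    exact ⟨w, by simp⟩

lemma zLoc_pow_dvd_pow (hp : p.Prime) {k l : ℕ} :
    (p : zLoc p) ^ k ∣ (p : zLoc p) ^ l ↔ k ≤ l := by
  have h := zLoc_pow_dvd_intCast (p := p) (k := k) (z := (p : ℤ) ^ l)
  push_cast at h
  rw [h]
  exact_mod_cast Nat.pow_dvd_pow_iff_le_right hp.one_lt

lemma zLoc_exists_eq_unit_mul_pow (hp : p.Prime) {x : zLoc p} (hx : x ≠ 0) :
    ∃ k : ℕ, Associated x ((p : zLoc p) ^ k) := by
  obtain ⟨b, hb, z, hz⟩ := zLoc_exists_den x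
  have hb' := zLoc_isUnit_natCast hp hb
  have hz0 : z ≠ 0 := by
    rintro rfl
    rw [map_zero] at hz
    exact hx ((hb'.mul_right_eq_zero).1 hz)
  have hfin : FiniteMultiplicity (p : ℤ) z :=
    Int.finiteMultiplicity_iff.2 ⟨by simpa using hp.ne_one, hz0⟩
  obtain ⟨m, hm, hpm⟩ := hfin.exists_eq_pow_mul_and_not_dvd
  generalize multiplicity (p : ℤ) z = k at hm
  refine ⟨k, ?_⟩
  have h1 : Associated ((b : zLoc p) * x) x := associated_unit_mul_left x _ hb'
  refine h1.symm.trans ?_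
  rw [hz, hm, map_mul, map_pow]
  simpa using associated_mul_unit_left ((p : zLoc p) ^ k) _
    (zLoc_isUnit_intCast hp hpm)

/-- Up to units every nonzero element is a power of `p`, so the least power of `p` in `J` generates
it. -/
lemma zLoc_exists_eq_span_pow (hp : p.Prime) {J : Ideal (zLoc p)} (hJ : J ≠ ⊥) :
    ∃ k : ℕ, J = Ideal.span {(p : zLoc p) ^ k} := by
  classical
  have key : ∀ x ∈ J, x ≠ 0 → ∃ k, (p : zLoc p) ^ k ∈ J ∧ (p : zLoc p) ^ k ∣ x := by
    intro x hx h0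
    obtain ⟨k, hk⟩ := zLoc_exists_eq_unit_mul_pow hp h0
    exact ⟨k, J.mem_of_dvd hk.dvd hx, hk.symm.dvd⟩
  obtain ⟨x, hx, h0⟩ := Submodule.exists_mem_ne_zero_of_ne_bot hJ
  have hex : ∃ k, (p : zLoc p) ^ k ∈ J := (key x hx h0).imp fun _ h => h.1
  refine ⟨Nat.find hex, le_antisymm (fun y hy => ?_) ?_⟩
  · rw [Ideal.mem_span_singleton]
    rcases eq_or_ne y 0 with rfl | hy0
    · exact dvd_zero _
    obtain ⟨k, hk, hky⟩ := key y hy hy0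
    exact (pow_dvd_pow _ (Nat.find_min' hex hk)).trans hky
  · rw [Ideal.span_singleton_le_iff_mem]
    exact Nat.find_spec hex

/-- The index can be computed in `ℤ`, since `ℤ` maps onto `ℤ_(p) / p^k` with kernel `p^k ℤ`. -/
lemma idealIndex_span_pow (k : ℕ) :
    idealIndex (Ideal.span {(p : zLoc p) ^ k}) = p ^ k := by
  let q := Ideal.Quotient.mk (Ideal.span {(p : zLoc p) ^ k})
  have hpk : q ((p : zLoc p) ^ k) = 0 :=
    Ideal.Quotient.eq_zero_iff_mem.2 (Ideal.mem_span_singleton_self _)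
  have hsurj : Function.Surjective (q.comp (Int.castRingHom (zLoc p))) := by
    intro y
    obtain ⟨y, rfl⟩ := Ideal.Quotient.mk_surjective y
    obtain ⟨x, z, rfl⟩ := exists_eq_map_add_pow_mul _ zLoc_exists_den k y
    refine ⟨x, ?_⟩
    rw [RingHom.comp_apply]
    push_cast
    rw [map_add, map_mul _ (_ ^ _) z]
    change _ = _ + q (_ ^ k) * _
    rw [hpk, zero_mul, add_zero]
  have h1 := idealIndex_comap (q := q) Ideal.Quotient.mk_surjective ⊥
  have h2 := idealIndex_comap hsurj ⊥
  have e1 : Ideal.comap q ⊥ = Ideal.span {(p : zLoc p) ^ k} := Ideal.mk_ker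
  have e2 : Ideal.comap (q.comp (Int.castRingHom (zLoc p))) ⊥ = Ideal.span {(p : ℤ) ^ k} := by
    ext z
    rw [Ideal.mem_comap, RingHom.comp_apply, Ideal.mem_bot, Ideal.Quotient.eq_zero_iff_mem,
      Ideal.mem_span_singleton, Ideal.mem_span_singleton]
    exact zLoc_pow_dvd_intCast
  rw [← e1, h1, ← h2, e2, idealIndex_span_int]
  simp

lemma zLoc_isUnit_of_ne (hp : p.Prime) (q : ℕ) (hq : q.Prime) (hqp : q ≠ p) :
    IsUnit (q : zLoc p) :=
  zLoc_isUnit_natCast hp ((Nat.coprime_primes hq hp).2 hqp)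

/-- `ζ_R(s) = ζ(s)_p` for `R = ℤ_(p)`. -/
lemma ringZeta_zLoc (hp : p.Prime) :
    ringZeta (zLoc p) = ArithmeticFunction.ofPowerSeries p
      (eulerSeries p (ArithmeticFunction.zeta : ArithmeticFunction ℤ)) := by
  rw [eq_ofPowerSeries_eulerSeries hp.one_lt (ringZeta (zLoc p))
    (ringZeta_eq_zero_of_not_pow (zLoc_isUnit_of_ne hp))]
  congr 1
  ext k
  rw [coeff_eulerSeries, coeff_eulerSeries, ← ringZeta_int,
    ringZeta_prime_pow_eq (Int.castRingHom (zLoc p)) hp Int.cast_injective zLoc_exists_den]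

/-- For `n` a power of `p` the ideals come from `R` modulo `n`; for other `n` there are none. -/
lemma finite_idealsOfIndex_of_den {R R' : Type*} [CommRing R] [CommRing R'] (φ : R →+* R')
    (hden : ∀ y : R', ∃ b : ℕ, b.Coprime p ∧ ∃ x : R, (b : R') * y = φ x)
    (hunit : ∀ q : ℕ, q.Prime → q ≠ p → IsUnit (q : R'))
    (hR : ∀ n, n ≠ 0 → (idealsOfIndex R n).Finite) {n : ℕ} (hn : n ≠ 0) :
    (idealsOfIndex R' n).Finite := by
  by_cases h : ∃ k, n = p ^ k
  · obtain ⟨k, rfl⟩ := h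
    exact finite_idealsOfIndex_of_mod φ (exists_eq_map_add_pow_mul φ hden k) (hR _ hn)
  · convert Set.finite_empty
    refine Set.eq_empty_of_forall_notMem fun I hI => h ?_
    have hI' : idealIndex I = n := hI
    exact hI' ▸ exists_idealIndex_eq_pow hunit I (hI' ▸ hn)

lemma finite_idealsOfIndex_zLoc (hp : p.Prime) {n : ℕ} (hn : n ≠ 0) :
    (idealsOfIndex (zLoc p) n).Finite :=
  finite_idealsOfIndex_of_den (Int.castRingHom (zLoc p)) zLoc_exists_den (zLoc_isUnit_of_ne hp)
    (fun _ => finite_idealsOfIndex_int) hn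

/-- `ℤ_(p)` as a valuation ring of `ℚ`. -/
def zLocValuation (hp : p.Prime) : ValuationSubring ℚ where
  __ := zLoc p
  mem_or_inv_mem' x := by
    change x.den.Coprime p ∨ x⁻¹.den.Coprime p
    rcases eq_or_ne x 0 with rfl | hx
    · simp
    by_contra! h
    have h1 : p ∣ x.den := by
      by_contra h'
      exact h.1 (hp.coprime_iff_not_dvd.2 h').symm
    have h2 : p ∣ x⁻¹.den := by
      by_contra h'
      exact h.2 (hp.coprime_iff_not_dvd.2 h').symm
    rw [Rat.den_inv_of_ne_zero hx] at h2
    exact hp.one_lt.ne' (Nat.eq_one_of_dvd_coprimes x.reduced h2 h1)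

lemma zLoc_isFractionRing (hp : p.Prime) : IsFractionRing (zLoc p) ℚ :=
  inferInstanceAs (IsFractionRing (zLocValuation hp) ℚ)

lemma zLoc_isIntegrallyClosed (hp : p.Prime) : IsIntegrallyClosed (zLoc p) :=
  inferInstanceAs (IsIntegrallyClosed (zLocValuation hp))

end zLoc

/-! ### Power series that are polynomials -/

/-- The polynomials, as a subring of the ring of power series. -/
def polySeries : Subring (PowerSeries ℤ) :=
  (Polynomial.coeToPowerSeries.ringHom : ℤ[X] →+* PowerSeries ℤ).range

lemma coe_mem_polySeries (δ : ℤ[X]) : (δ : PowerSeries ℤ) ∈ polySeries :=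
  ⟨δ, Polynomial.coeToPowerSeries.ringHom_apply⟩

lemma exists_coe_eq_of_mem_polySeries {g : PowerSeries ℤ} (hg : g ∈ polySeries) :
    ∃ δ : ℤ[X], (δ : PowerSeries ℤ) = g := by
  obtain ⟨δ, rfl⟩ := hg
  exact ⟨δ, Polynomial.coeToPowerSeries.ringHom_apply.symm⟩

lemma X_mem_polySeries : (PowerSeries.X : PowerSeries ℤ) ∈ polySeries := by
  simpa using coe_mem_polySeries X

/-- Used to discard the factor `X^l` caused by measuring indices in `ℤ_(p)^ι` instead of in `Λ`. -/
lemma mem_polySeries_of_X_pow_mul {l : ℕ} {g : PowerSeries ℤ}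
    (h : PowerSeries.X ^ l * g ∈ polySeries) : g ∈ polySeries := by
  obtain ⟨δ, hδ⟩ := exists_coe_eq_of_mem_polySeries h
  have hdvd : X ^ l ∣ δ := by
    rw [Polynomial.X_pow_dvd_iff]
    intro d hd
    rw [← Polynomial.coeff_coe, hδ, PowerSeries.coeff_X_pow_mul', if_neg (by omega)]
  obtain ⟨ε, rfl⟩ := hdvd
  rw [Polynomial.coe_mul, Polynomial.coe_pow, Polynomial.coe_X] at hδ
  have := mul_left_cancel₀ (pow_ne_zero l PowerSeries.X_ne_zero) hδ
  exact this ▸ coe_mem_polySeries ε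

/-- The series is `X^b` for `b < r`, the geometric tail `X^r / (1 - X)` for `b = r`, and `0` for `b
> r`. -/
lemma mk_min_eq_mul_mem_polySeries (r b : ℕ) :
    (PowerSeries.mk fun n => if min n r = b then (1 : ℤ) else 0) * (1 - PowerSeries.X) ∈
      polySeries := by
  have hX : (1 - PowerSeries.X : PowerSeries ℤ) ∈ polySeries :=
    sub_mem (one_mem _) X_mem_polySeries
  rcases lt_trichotomy b r with h | rfl | h
  · have : (PowerSeries.mk fun n => if min n r = b then (1 : ℤ) else 0) = PowerSeries.X ^ b := by
      ext n
      rw [PowerSeries.coeff_mk, PowerSeries.coeff_X_pow]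
      exact if_congr (by omega) rfl rfl
    rw [this]
    exact mul_mem (pow_mem X_mem_polySeries b) hX
  · have : (PowerSeries.mk fun n => if min n b = b then (1 : ℤ) else 0) =
        PowerSeries.X ^ b * PowerSeries.mk 1 := by
      ext n
      rw [PowerSeries.coeff_mk, PowerSeries.coeff_X_pow_mul', PowerSeries.coeff_mk]
      exact if_congr (by omega) rfl rfl
    rw [this, mul_assoc, PowerSeries.mk_one_mul_one_sub_eq_one, mul_one]
    exact pow_mem X_mem_polySeries b
  · have : (PowerSeries.mk fun n => if min n r = b then (1 : ℤ) else 0) = 0 := by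
      ext n
      rw [PowerSeries.coeff_mk, if_neg (by omega), map_zero]
    rw [this, zero_mul]
    exact zero_mem _

section Counting

variable {ι : Type*} [Fintype ι] [DecidableEq ι]

lemma coeff_prod_mk_indicator (Q : ι → ℕ → Prop) [∀ i n, Decidable (Q i n)] (j : ℕ) :
    (∏ i, PowerSeries.mk fun n => if Q i n then (1 : ℤ) else 0).coeff j =
      (((Finset.univ : Finset ι).piAntidiag j).filter fun a => ∀ i, Q i (a i)).card := by
  rw [PowerSeries.coeff_prod, Finset.card_filter]
  push_cast
  refine Finset.sum_nbij (fun l => ⇑l) ?_ ?_ ?_ ?_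
  · intro l hl
    simpa [Finset.mem_piAntidiag, Finset.mem_finsuppAntidiag] using hl
  · exact DFunLike.coe_injective.injOn
  · intro a ha
    refine ⟨Finsupp.equivFunOnFinite.symm a, ?_, rfl⟩
    simpa [Finset.mem_piAntidiag, Finset.mem_finsuppAntidiag] using ha
  · intro l _
    simp only [PowerSeries.coeff_mk, Finset.prod_ite_zero]
    simp

/-- The number of points of `ℕ^ι` on the hyperplanes `∑ a_i = j` that satisfy a condition depending
only on the truncations `min (a_i) r`. -/
lemma mk_card_mul_mem_polySeries (P : (ι → ℕ) → Prop) [DecidablePred P] (r : ℕ)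
    (hP : ∀ a, P a ↔ P fun i => min (a i) r) :
    (PowerSeries.mk fun j =>
      ((((Finset.univ : Finset ι).piAntidiag j).filter P).card : ℤ)) *
        (1 - PowerSeries.X) ^ Fintype.card ι ∈ polySeries := by
  -- The points are sorted by their truncation `b ∈ {0, …, r}^ι`. Each fibre is cut out by separate
  -- conditions on the coordinates, so its generating function is a product.
  have h : (PowerSeries.mk fun j =>
      ((((Finset.univ : Finset ι).piAntidiag j).filter P).card : ℤ)) =
      ∑ b ∈ (Fintype.piFinset fun _ : ι => Finset.range (r + 1)).filter P,
        ∏ i, PowerSeries.mk fun n => if min n r = b i then (1 : ℤ) else 0 := by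
    ext j
    rw [PowerSeries.coeff_mk, map_sum]
    simp_rw [coeff_prod_mk_indicator]
    rw [← Nat.cast_sum, Finset.card_eq_sum_card_fiberwise (f := fun a i => min (a i) r)
      (t := (Fintype.piFinset fun _ : ι => Finset.range (r + 1)).filter P)]
    · congr 1
      refine Finset.sum_congr rfl fun b hb => ?_
      congr 1
      ext a
      simp only [Finset.mem_filter, funext_iff]
      refine ⟨fun h => ⟨h.1.1, h.2⟩, fun h => ⟨⟨h.1, ?_⟩, h.2⟩⟩
      rw [hP, show (fun i => min (a i) r) = b from funext h.2]
      exact (Finset.mem_filter.1 hb).2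
    · intro a ha
      simp only [Finset.coe_filter, Set.mem_ofPred_eq, Fintype.mem_piFinset,
        Finset.mem_range] at ha ⊢
      exact ⟨fun i => by omega, (hP a).1 ha.2⟩
  rw [h, Finset.sum_mul]
  refine sum_mem fun b _ => ?_
  rw [← Finset.card_univ, ← Finset.prod_const, ← Finset.prod_mul_distrib]
  exact prod_mem fun i _ => mk_min_eq_mul_mem_polySeries r (b i)

end Counting

/-! ### Lattices in `ℤ_(p)^ι` over a subring of `p`-power index -/

section Lattice

variable {ι : Type*} {p : ℕ} (Λ : Subalgebra (zLoc p) (ι → zLoc p))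

/-- Multiplication by `(p^{a_i})_i`. -/
def shift (a : ι → ℕ) : (ι → zLoc p) →ₗ[Λ] (ι → zLoc p) :=
  LinearMap.mulLeft Λ fun i => (p : zLoc p) ^ a i

variable {Λ}

@[simp] lemma shift_apply (a : ι → ℕ) (x : ι → zLoc p) (i : ι) :
    shift Λ a x i = (p : zLoc p) ^ a i * x i := rfl

lemma shift_injective (hp : p.Prime) (a : ι → ℕ) : Function.Injective (shift Λ a) := by
  intro x y h
  have hp0 : (p : zLoc p) ≠ 0 := by exact_mod_cast hp.ne_zero
  funext i
  exact mul_left_cancel₀ (pow_ne_zero (a i) hp0) (congrFun h i)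

lemma index_range_shift [Fintype ι] (a : ι → ℕ) :
    (LinearMap.range (shift Λ a)).toAddSubgroup.index = p ^ ∑ i, a i := by
  have h : (LinearMap.range (shift Λ a)).toAddSubgroup = AddSubgroup.pi Set.univ
      fun i => Submodule.toAddSubgroup (Ideal.span {(p : zLoc p) ^ a i}) := by
    ext x
    simp only [Submodule.mem_toAddSubgroup, LinearMap.mem_range, AddSubgroup.mem_pi, Set.mem_univ,
      true_imp_iff, Ideal.mem_span_singleton, dvd_def]
    constructor
    · rintro ⟨y, rfl⟩ i
      exact ⟨y i, rfl⟩
    · intro h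
      choose y hy using h
      exact ⟨y, funext fun i => (hy i).symm⟩
  rw [h, AddSubgroup.index_pi, ← Finset.prod_pow_eq_pow_sum]
  exact Finset.prod_congr rfl fun i _ => idealIndex_span_pow (a i)

lemma index_map_shift [Fintype ι] (hp : p.Prime) (a : ι → ℕ) (L : Submodule Λ (ι → zLoc p)) :
    (L.map (shift Λ a)).toAddSubgroup.index = L.toAddSubgroup.index * p ^ ∑ i, a i := by
  rw [← index_range_shift (Λ := Λ) a]
  exact AddSubgroup.index_map_of_injective L.toAddSubgroup
    (f := (shift Λ a).toAddMonoidHom) (shift_injective (Λ := Λ) hp a)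

/-- A lattice all of whose coordinate projections are surjective. -/
def IsPrimitive (L : Submodule Λ (ι → zLoc p)) : Prop := ∀ i, ∃ y ∈ L, y i = 1

/-- An element of `L` with `i`-th coordinate `1` is shifted to one with `i`-th coordinate `p^{a_i}`,
which must be divisible by `p^{b_i}`. -/
lemma map_shift_le_iff_of_isPrimitive (hp : p.Prime) {L M : Submodule Λ (ι → zLoc p)} (hL : IsPrimitive L)
    {a b : ι → ℕ} (h : L.map (shift Λ a) ≤ M.map (shift Λ b)) : b ≤ a := by
  intro i
  obtain ⟨y, hy, hyi⟩ := hL i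
  obtain ⟨z, -, hz⟩ := h (Submodule.mem_map_of_mem hy)
  have h1 := congrFun hz i
  rw [shift_apply, shift_apply, hyi, mul_one] at h1
  exact (zLoc_pow_dvd_pow hp).1 ⟨z i, h1.symm⟩

lemma map_shift_inj (hp : p.Prime) {L M : Submodule Λ (ι → zLoc p)} (hL : IsPrimitive L) (hM : IsPrimitive M)
    {a b : ι → ℕ} (h : L.map (shift Λ a) = M.map (shift Λ b)) : L = M ∧ a = b := by
  have hab : a = b := le_antisymm (map_shift_le_iff_of_isPrimitive hp hM h.ge)
    (map_shift_le_iff_of_isPrimitive hp hL h.le)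
  subst hab
  exact ⟨Submodule.map_injective_of_injective (shift_injective hp a) h, rfl⟩

/-- Each coordinate projection of `L` is a nonzero ideal `(p^{a_i})`; dividing the `i`-th
coordinates by `p^{a_i}` gives the primitive lattice. -/
lemma exists_eq_map_shift (hp : p.Prime) (L : Submodule Λ (ι → zLoc p)) (hL : L.toAddSubgroup.index ≠ 0) :
    ∃ M : Submodule Λ (ι → zLoc p), IsPrimitive M ∧ ∃ a, L = M.map (shift Λ a) := by
  let J (i : ι) : Ideal (zLoc p) := (L.restrictScalars (zLoc p)).map (LinearMap.proj i)
  have hJ : ∀ i, J i ≠ ⊥ := by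
    intro i h
    -- The index times `(1, …, 1)` lies in `L` and has nonzero coordinates.
    have h1 : L.toAddSubgroup.index • (1 : ι → zLoc p) ∈ L.toAddSubgroup :=
      AddSubgroup.nsmul_index_mem _ _
    have h2 : ((L.toAddSubgroup.index : ℕ) : zLoc p) ∈ J i := ⟨_, h1, by simp⟩
    rw [h, Ideal.mem_bot] at h2
    exact hL (by exact_mod_cast h2)
  choose a ha using fun i => zLoc_exists_eq_span_pow hp (hJ i)
  have hle : L ≤ LinearMap.range (shift Λ a) := by
    intro x hx
    have h1 : ∀ i, (p : zLoc p) ^ a i ∣ x i := fun i => by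
      rw [← Ideal.mem_span_singleton, ← ha i]
      exact ⟨x, hx, rfl⟩
    choose y hy using h1
    exact ⟨y, funext fun i => (hy i).symm⟩
  refine ⟨L.comap (shift Λ a), fun i => ?_, a, ?_⟩
  · have h1 : (p : zLoc p) ^ a i ∈ J i := ha i ▸ Ideal.mem_span_singleton_self _
    obtain ⟨x, hx, hxi⟩ := h1
    obtain ⟨y, rfl⟩ := hle hx
    refine ⟨y, hx, ?_⟩
    have hp0 : (p : zLoc p) ≠ 0 := by exact_mod_cast hp.ne_zero
    refine mul_left_cancel₀ (pow_ne_zero (a i) hp0) ?_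
    rw [mul_one]
    exact hxi
  · rw [Submodule.map_comap_eq, inf_eq_right.2 hle]

/-- Take `y_i ∈ L` with `i`-th coordinate `1`. The vector with single entry `p^r x_i` at `i` lies in
`Λ`, and multiplying `y_i` by it isolates the `i`-th coordinate of `p^r x`. -/
lemma IsPrimitive.pow_smul_mem [Fintype ι] {r : ℕ}
    (hr : ∀ x : ι → zLoc p, (p : zLoc p) ^ r • x ∈ Λ) {L : Submodule Λ (ι → zLoc p)}
    (hL : IsPrimitive L) (x : ι → zLoc p) : (p : zLoc p) ^ r • x ∈ L := by
  classical
  choose y hy hyi using hL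
  have h : (p : zLoc p) ^ r • x = ∑ i, (p : zLoc p) ^ r • Pi.single i (x i) * y i := by
    funext j
    rw [Finset.sum_apply, Finset.sum_eq_single j]
    · simp [hyi]
    · intro i _ hij
      simp [hij.symm]
    · simp
  rw [h]
  exact sum_mem fun i _ => L.smul_mem ⟨_, hr (Pi.single i (x i))⟩ (hy i)

lemma IsPrimitive.range_shift_le [Fintype ι] {r : ℕ}
    (hr : ∀ x : ι → zLoc p, (p : zLoc p) ^ r • x ∈ Λ) {L : Submodule Λ (ι → zLoc p)}
    (hL : IsPrimitive L) : LinearMap.range (shift Λ fun _ => r) ≤ L := by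
  rintro _ ⟨x, rfl⟩
  exact hL.pow_smul_mem hr x

/-- All primitive lattices lie between `p^r ℤ_(p)^ι` and `ℤ_(p)^ι`, whose quotient is finite. -/
lemma finite_setOf_isPrimitive [Fintype ι] (hp : p.Prime) {r : ℕ}
    (hr : ∀ x : ι → zLoc p, (p : zLoc p) ^ r • x ∈ Λ) :
    {L : Submodule Λ (ι → zLoc p) | IsPrimitive L}.Finite := by
  let N := LinearMap.range (shift Λ fun _ : ι => r)
  have hN : N.toAddSubgroup.index ≠ 0 := by
    rw [index_range_shift]
    exact pow_ne_zero _ hp.ne_zero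
  have : Finite ((ι → zLoc p) ⧸ N) := (AddSubgroup.fintypeOfIndexNeZero hN).finite
  have : Finite (Submodule Λ ((ι → zLoc p) ⧸ N)) := Finite.of_injective _ SetLike.coe_injective
  have : Finite (Set.Ici N) := Finite.of_equiv _ (Submodule.comapMkQRelIso N).toEquiv
  exact (Set.toFinite (Set.Ici N)).subset fun L hL => IsPrimitive.range_shift_le hr hL

lemma exists_index_eq_pow_of_range_shift_le [Fintype ι] (hp : p.Prime) {r : ℕ}
    {L : Submodule Λ (ι → zLoc p)} (h : LinearMap.range (shift Λ fun _ => r) ≤ L) :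
    ∃ e, L.toAddSubgroup.index = p ^ e := by
  have h1 : L.toAddSubgroup.index ∣ (LinearMap.range (shift Λ fun _ => r)).toAddSubgroup.index :=
    AddSubgroup.index_dvd_of_le h
  rw [index_range_shift] at h1
  obtain ⟨e, -, he⟩ := (Nat.dvd_prime_pow hp).1 h1
  exact ⟨e, he⟩

variable (Λ) in
/-- The subring `Λ` as a lattice. -/
def selfLattice : Submodule Λ (ι → zLoc p) := LinearMap.range (Algebra.linearMap Λ (ι → zLoc p))

lemma mem_selfLattice {x : ι → zLoc p} : x ∈ selfLattice Λ ↔ x ∈ Λ :=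
  ⟨fun ⟨y, hy⟩ => hy ▸ y.2, fun h => ⟨⟨x, h⟩, rfl⟩⟩

/-- Whether `p^a L ⊆ Λ` depends only on the truncation of `a` at the conductor exponent. -/
lemma map_shift_le_selfLattice_iff {r : ℕ} (hr : ∀ x : ι → zLoc p, (p : zLoc p) ^ r • x ∈ Λ)
    (L : Submodule Λ (ι → zLoc p)) (a : ι → ℕ) :
    L.map (shift Λ a) ≤ selfLattice Λ ↔
      L.map (shift Λ fun i => min (a i) r) ≤ selfLattice Λ := by
  -- When `a_i ≥ r`, the difference `p^{a_i} - p^r` is divisible by `p^r`; otherwise the two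
  -- exponents agree.
  have key : ∀ x : ι → zLoc p, shift Λ a x - shift Λ (fun i => min (a i) r) x ∈ Λ := by
    intro x
    have h : shift Λ a x - shift Λ (fun i => min (a i) r) x = (p : zLoc p) ^ r •
        fun i => ((p : zLoc p) ^ (a i - r) - 1) * x i := by
      funext i
      rw [Pi.sub_apply, Pi.smul_apply, shift_apply, shift_apply, smul_eq_mul]
      rcases le_total (a i) r with h | h
      · simp [h]
      · rw [min_eq_right h]
        nth_rw 1 [← Nat.add_sub_cancel' h]
        rw [pow_add]
        ring
    rw [h]
    exact hr _
  simp only [Submodule.map_le_iff_le_comap]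
  refine forall₂_congr fun x _ => ?_
  rw [Submodule.mem_comap, Submodule.mem_comap, mem_selfLattice, mem_selfLattice]
  constructor
  · intro h
    simpa using sub_mem h (key x)
  · intro h
    simpa using add_mem h (key x)

/-- Ideals of `Λ` correspond to the sublattices of `ℤ_(p)^ι` contained in `Λ`. -/
lemma ncard_idealsOfIndex_eq_ncard_lattices {l : ℕ}
    (hl : (selfLattice Λ).toAddSubgroup.index = p ^ l) (hp : p.Prime) (k : ℕ) :
    (idealsOfIndex Λ (p ^ k)).ncard = {L : Submodule Λ (ι → zLoc p) |
      L ≤ selfLattice Λ ∧ L.toAddSubgroup.index = p ^ (k + l)}.ncard := by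
  have hinj : Function.Injective (Algebra.linearMap Λ (ι → zLoc p)) := Subtype.val_injective
  rw [← Set.ncard_image_of_injective _ (Submodule.map_injective_of_injective hinj)]
  congr 1
  have hindex : ∀ I : Ideal Λ,
      (Submodule.map (Algebra.linearMap Λ (ι → zLoc p)) I).toAddSubgroup.index =
        idealIndex I * p ^ l := by
    intro I
    rw [← hl]
    exact AddSubgroup.index_map_of_injective (Submodule.toAddSubgroup I)
      (f := (Algebra.linearMap Λ (ι → zLoc p)).toAddMonoidHom) hinj
  ext L
  constructor
  · rintro ⟨I, hI, rfl⟩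
    refine ⟨LinearMap.map_le_range, ?_⟩
    rw [hindex, show idealIndex I = p ^ k from hI, pow_add]
  · rintro ⟨hle, hL⟩
    have h : Submodule.map (Algebra.linearMap Λ (ι → zLoc p))
        (L.comap (Algebra.linearMap Λ (ι → zLoc p))) = L := by
      rw [Submodule.map_comap_eq]
      exact inf_eq_right.2 hle
    refine ⟨_, ?_, h⟩
    rw [← h, hindex, pow_add] at hL
    exact Nat.eq_of_mul_eq_mul_right (pow_pos hp.pos l) hL

/-- The number of ideals of `p`-power index of a subring of `ℤ_(p)^ι` containing `p^r ℤ_(p)^ι`: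
after multiplication by `(1 - X)^|ι|` the generating function is a polynomial. -/
theorem mk_ncard_idealsOfIndex_mul_mem_polySeries [Fintype ι] (hp : p.Prime) {r : ℕ}
    (hr : ∀ x : ι → zLoc p, (p : zLoc p) ^ r • x ∈ Λ) :
    (PowerSeries.mk fun k => ((idealsOfIndex Λ (p ^ k)).ncard : ℤ)) *
      (1 - PowerSeries.X) ^ Fintype.card ι ∈ polySeries := by
  classical
  obtain ⟨l, hl⟩ : ∃ l, (selfLattice Λ).toAddSubgroup.index = p ^ l :=
    exists_index_eq_pow_of_range_shift_le hp (r := r) (by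
      rintro _ ⟨x, rfl⟩
      exact mem_selfLattice.2 (hr x))
  let F := (finite_setOf_isPrimitive hp hr).toFinset
  have hF : ∀ L, L ∈ F ↔ IsPrimitive L := fun L => by simp [F]
  -- The exponent `0` for lattices that are not primitive is a dummy value.
  have he : ∀ L : Submodule Λ (ι → zLoc p), ∃ e, IsPrimitive L → L.toAddSubgroup.index = p ^ e := by
    intro L
    by_cases hL : IsPrimitive L
    · obtain ⟨e, he⟩ := exists_index_eq_pow_of_range_shift_le hp (hL.range_shift_le hr)
      exact ⟨e, fun _ => he⟩
    · exact ⟨0, fun h => absurd h hL⟩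
  choose e he using he
  let P (L : Submodule Λ (ι → zLoc p)) (a : ι → ℕ) : Prop := L.map (shift Λ a) ≤ selfLattice Λ
  let g (L : Submodule Λ (ι → zLoc p)) : PowerSeries ℤ := PowerSeries.mk fun j =>
    ((((Finset.univ : Finset ι).piAntidiag j).filter (P L)).card : ℤ)
  let N (m : ℕ) : ℕ := {L : Submodule Λ (ι → zLoc p) |
      L ≤ selfLattice Λ ∧ L.toAddSubgroup.index = p ^ m}.ncard
  -- Every lattice counted by `N m` is uniquely `p^a M` with `M` primitive, and its index has
  -- exponent `e M + ∑ a_i`.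
  have hN : PowerSeries.mk (fun m => (N m : ℤ)) = ∑ L ∈ F, PowerSeries.X ^ e L * g L := by
    ext m
    rw [PowerSeries.coeff_mk, map_sum]
    let T : Finset (Σ _ : Submodule Λ (ι → zLoc p), ι → ℕ) := F.sigma fun L =>
      if e L ≤ m then ((Finset.univ : Finset ι).piAntidiag (m - e L)).filter (P L) else ∅
    have hT : ∀ x, x ∈ T ↔ IsPrimitive x.1 ∧ P x.1 x.2 ∧ e x.1 + ∑ i, x.2 i = m := by
      rintro ⟨L, a⟩
      rw [Finset.mem_sigma, hF]
      refine and_congr_right fun _ => ?_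
      split_ifs with h
      · simp only [Finset.mem_filter, Finset.mem_piAntidiag, Finset.mem_univ, implies_true,
          and_true]
        rw [and_comm]
        refine and_congr_right fun _ => ?_
        change ∑ i, a i = m - e L ↔ e L + ∑ i, a i = m
        change e L ≤ m at h
        omega
      · refine iff_of_false (Finset.notMem_empty a) fun h' => ?_
        have : e L + ∑ i, a i = m := h'.2
        change ¬ e L ≤ m at h
        omega
    have hNT : N m = T.card := by
      have hinj : Set.InjOn (fun x : (Σ _ : Submodule Λ (ι → zLoc p), ι → ℕ) =>
          x.1.map (shift Λ x.2)) T := by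
        rintro ⟨M, a⟩ hx ⟨M', a'⟩ hx' h
        obtain ⟨rfl, rfl⟩ := map_shift_inj hp ((hT _).1 (Finset.mem_coe.1 hx)).1
          ((hT _).1 (Finset.mem_coe.1 hx')).1 h
        rfl
      rw [← Set.ncard_coe_finset, ← hinj.ncard_image]
      change Set.ncard _ = _
      congr 1
      ext L
      constructor
      · rintro ⟨hle, hL⟩
        obtain ⟨M, hM, a, rfl⟩ := exists_eq_map_shift hp L
          (by rw [hL]; exact pow_ne_zero _ hp.ne_zero)
        refine ⟨⟨M, a⟩, (hT _).2 ⟨hM, hle, ?_⟩, rfl⟩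
        rw [index_map_shift hp, he M hM, ← pow_add] at hL
        exact Nat.pow_right_injective hp.two_le hL
      · rintro ⟨⟨M, a⟩, hx, rfl⟩
        obtain ⟨hM, hle, hsum⟩ := (hT _).1 (Finset.mem_coe.1 hx)
        refine ⟨hle, ?_⟩
        rw [index_map_shift hp, he M hM, ← pow_add, hsum]
    rw [hNT, Finset.card_sigma]
    push_cast
    refine Finset.sum_congr rfl fun L _ => ?_
    rw [PowerSeries.coeff_X_pow_mul']
    split_ifs with h
    · rw [PowerSeries.coeff_mk]
    · simp
  have hpoly : PowerSeries.mk (fun m => (N m : ℤ)) *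
      (1 - PowerSeries.X) ^ Fintype.card ι ∈ polySeries := by
    rw [hN, Finset.sum_mul]
    refine sum_mem fun L _ => ?_
    rw [mul_assoc]
    exact mul_mem (pow_mem X_mem_polySeries _)
      (mk_card_mul_mem_polySeries (P L) r (map_shift_le_selfLattice_iff hr L))
  refine mem_polySeries_of_X_pow_mul (l := l) ?_
  -- An ideal of index `p^k` in `Λ` has index `p^(k + l)` in `ℤ_(p)^ι`. Subtracting the truncation
  -- avoids having to know that the coefficients below `l` vanish.
  have hshift : PowerSeries.X ^ l *
      (PowerSeries.mk fun k => ((idealsOfIndex Λ (p ^ k)).ncard : ℤ)) =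
      PowerSeries.mk (fun m => (N m : ℤ)) - 
        ((PowerSeries.trunc l (PowerSeries.mk fun m => (N m : ℤ)) : ℤ[X]) : PowerSeries ℤ) := by
    ext m
    rw [PowerSeries.coeff_X_pow_mul', map_sub, Polynomial.coeff_coe, PowerSeries.coeff_trunc]
    simp only [PowerSeries.coeff_mk]
    rcases le_or_gt l m with h | h
    · rw [if_pos h, if_neg (by omega), sub_zero, ncard_idealsOfIndex_eq_ncard_lattices hl hp,
        Nat.sub_add_cancel h]
    · rw [if_neg (by omega), if_pos h, sub_self]
  rw [← mul_assoc, hshift, sub_mul]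
  exact sub_mem hpoly (mul_mem (coe_mem_polySeries _)
    (pow_mem (sub_mem (one_mem _) X_mem_polySeries) _))

end Lattice

/-! ### The ring `S[x] / x (x - α) (x - β)` -/

section Cubic

/-- The roots `0, α, β` of the polynomial `x (x - α) (x - β)`. -/
def cubicRoot (α β : ℤ) : Fin 3 → ℤ := ![0, α, β]

/-- The product `α β (β - α)` of the differences of the roots. -/
def rootProduct (α β : ℤ) : ℤ := α * β * (β - α)

section CommRing

variable (S : Type*) [CommRing S] (α β : ℤ)

lemma monic_cubic : (cubic S α β).Monic :=
  (monic_X.mul (monic_X_sub_C _)).mul (monic_X_sub_C _)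

lemma map_cubic {S T : Type*} [CommRing S] [CommRing T] (f : S →+* T) (α β : ℤ) :
    (cubic S α β).map f = cubic T α β := by
  simp [cubic]

lemma aeval_cubic {T : Type*} [Ring T] [Algebra S T] (x : T) :
    aeval x (cubic S α β) = x * (x - (α : T)) * (x - (β : T)) := by
  simp [cubic]

lemma eval_cubic (x : S) : (cubic S α β).eval x = x * (x - α) * (x - β) := by
  simp [cubic]

/-- Evaluation of a residue class of polynomials at a root. -/
def cubicEval (i : Fin 3) : AdjoinRoot (cubic S α β) →ₐ[S] S :=
  AdjoinRoot.liftAlgHom _ (AlgHom.id S S) (cubicRoot α β i : S) (by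
    change eval₂ (RingHom.id S) _ _ = 0
    rw [eval₂_id, eval_cubic]
    fin_cases i <;> simp [cubicRoot])

@[simp] lemma cubicEval_root (i : Fin 3) :
    cubicEval S α β i (AdjoinRoot.root _) = (cubicRoot α β i : S) :=
  AdjoinRoot.liftAlgHom_root ..

lemma cubicEval_mk (i : Fin 3) (g : S[X]) :
    cubicEval S α β i (AdjoinRoot.mk _ g) = g.eval (cubicRoot α β i : S) := by
  rw [cubicEval, AdjoinRoot.liftAlgHom_mk]
  exact eval₂_id

/-- Evaluation at the three roots. -/
def cubicEvals : AdjoinRoot (cubic S α β) →ₐ[S] (Fin 3 → S) :=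
  AlgHom.pi (cubicEval S α β)

lemma cubicEvals_apply (x : AdjoinRoot (cubic S α β)) (i : Fin 3) :
    cubicEvals S α β x i = cubicEval S α β i x := rfl

variable {S} in
/-- The Lagrange interpolation polynomials at the roots (multiplied by `αβ(β - α)`),
at an element `x` of an `S`-algebra. -/
def lagrange {T : Type*} [CommRing T] (x : T) : Fin 3 → T :=
  ![(β - α) * ((x - α) * (x - β)), -β * (x * (x - β)), α * (x * (x - α))]

/-- The scalar in front of each product supplies the factors of `αβ(β - α)`, with sign, that are
missing from its value at its own root. -/
lemma cubicEval_lagrange (i j : Fin 3) :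
    cubicEval S α β j (lagrange α β (AdjoinRoot.root (cubic S α β)) i) =
      if i = j then (rootProduct α β : S) else 0 := by
  fin_cases i <;> fin_cases j <;> simp [lagrange, cubicRoot, rootProduct] <;> ring

/-- Lagrange interpolation with cleared denominators. It bounds the conductor of the image in `S^3`.
-/
lemma rootProduct_smul_mem_range (x : Fin 3 → S) :
    (rootProduct α β : S) • x ∈ (cubicEvals S α β).range := by
  refine ⟨∑ i, x i • lagrange α β (AdjoinRoot.root (cubic S α β)) i, ?_⟩
  funext j
  change cubicEvals S α β _ j = _
  rw [cubicEvals_apply, map_sum, Finset.sum_eq_single j]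
  · rw [map_smul, cubicEval_lagrange, if_pos rfl, Pi.smul_apply, smul_eq_mul, smul_eq_mul, mul_comm]
  · intro i _ hij
    rw [map_smul, cubicEval_lagrange, if_neg hij, smul_zero]
  · simp

lemma cubicEvals_surjective (h : IsUnit (rootProduct α β : S)) :
    Function.Surjective (cubicEvals S α β) := by
  intro x
  obtain ⟨u, hu⟩ := h
  obtain ⟨y, hy⟩ := rootProduct_smul_mem_range S α β ((↑u⁻¹ : S) • x)
  refine ⟨y, hy.trans ?_⟩
  rw [← hu, smul_smul, Units.mul_inv, one_smul]

end CommRing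

section Distinct

variable {α β : ℤ}

lemma rootProduct_ne_zero (hα : α ≠ 0) (hβ : β ≠ 0) (hαβ : α ≠ β) : rootProduct α β ≠ 0 :=
  mul_ne_zero (mul_ne_zero hα hβ) (sub_ne_zero.2 hαβ.symm)

/-- In a domain of characteristic zero the three roots stay distinct, so the linear factors can be
split off one after the other. -/
lemma cubicEvals_injective (S : Type*) [CommRing S] [IsDomain S] [CharZero S]
    (hα : α ≠ 0) (hβ : β ≠ 0) (hαβ : α ≠ β) : Function.Injective (cubicEvals S α β) := by
  rw [injective_iff_map_eq_zero]
  intro x hx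
  obtain ⟨g, rfl⟩ := AdjoinRoot.mk_surjective x
  have h : ∀ i, g.eval (cubicRoot α β i : S) = 0 := fun i => by
    rw [← cubicEval_mk, ← cubicEvals_apply, hx, Pi.zero_apply]
  have h0 : g.eval 0 = 0 := by simpa [cubicRoot] using h 0
  have h1 : g.eval (α : S) = 0 := by simpa [cubicRoot] using h 1
  have h2 : g.eval (β : S) = 0 := by simpa [cubicRoot] using h 2
  have hα' : (α : S) ≠ 0 := by exact_mod_cast hα
  have hβ' : (β : S) ≠ 0 := by exact_mod_cast hβ
  have hαβ' : (β : S) - α ≠ 0 := sub_ne_zero.2 (by exact_mod_cast hαβ.symm)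
  obtain ⟨g, rfl⟩ := X_dvd_iff.2 ((coeff_zero_eq_eval_zero g).trans h0)
  rw [eval_mul, eval_X] at h1 h2
  obtain ⟨g, rfl⟩ := dvd_iff_isRoot.2 ((mul_eq_zero.1 h1).resolve_left hα')
  rw [eval_mul, eval_sub, eval_X, eval_C] at h2
  obtain ⟨g, rfl⟩ := dvd_iff_isRoot.2
    ((mul_eq_zero.1 ((mul_eq_zero.1 h2).resolve_left hβ')).resolve_left hαβ')
  rw [AdjoinRoot.mk_eq_zero]
  exact ⟨g, by rw [cubic, mul_assoc, mul_assoc]⟩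

end Distinct

/-! ### The local rings -/

section Local

variable {α β : ℤ} {p : ℕ}

/-- The map `ℤ[x] / x (x - α) (x - β) → R_p`. -/
def toLocalRing (α β : ℤ) (p : ℕ) : AdjoinRoot (cubic ℤ α β) →+* localRing α β p :=
  AdjoinRoot.lift (Int.castRingHom _) (AdjoinRoot.root (cubic (zLoc p) α β)) (by
    have h : aeval (AdjoinRoot.root (cubic (zLoc p) α β)) (cubic (zLoc p) α β) = 0 := by
      rw [AdjoinRoot.aeval_eq, AdjoinRoot.mk_self]
    rw [aeval_cubic] at h
    rw [← h]
    exact aeval_cubic ℤ α β (AdjoinRoot.root (cubic (zLoc p) α β)))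

lemma cubicEval_toLocalRing (i : Fin 3) (x : AdjoinRoot (cubic ℤ α β)) :
    cubicEval (zLoc p) α β i (toLocalRing α β p x) = (cubicEval ℤ α β i x : zLoc p) := by
  have h : ((cubicEval (zLoc p) α β i : localRing α β p →+* zLoc p).comp (toLocalRing α β p)) =
      (Int.castRingHom (zLoc p)).comp (cubicEval ℤ α β i : AdjoinRoot (cubic ℤ α β) →+* ℤ) := by
    refine AdjoinRoot.ringHom_ext ?_ ?_
    · exact RingHom.ext_int _ _
    · simp [toLocalRing]
  exact RingHom.congr_fun h x

lemma toLocalRing_injective (hα : α ≠ 0) (hβ : β ≠ 0) (hαβ : α ≠ β) :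
    Function.Injective (toLocalRing α β p) := by
  intro x y h
  refine cubicEvals_injective ℤ hα hβ hαβ (funext fun i => ?_)
  have h1 := congrArg (cubicEval (zLoc p) α β i) h
  rw [cubicEval_toLocalRing, cubicEval_toLocalRing] at h1
  exact_mod_cast h1

lemma localRing_exists_den (y : localRing α β p) : ∃ b : ℕ, b.Coprime p ∧
    ∃ x : AdjoinRoot (cubic ℤ α β), (b : localRing α β p) * y = toLocalRing α β p x := by
  have hy : y ∈ Algebra.adjoin (zLoc p) {AdjoinRoot.root (cubic (zLoc p) α β)} := by
    rw [AdjoinRoot.adjoinRoot_eq_top]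
    trivial
  induction hy using Algebra.adjoin_induction with
  | mem y hy =>
    obtain rfl := hy
    exact ⟨1, by simp, AdjoinRoot.root _, by simp [toLocalRing]⟩
  | algebraMap s =>
    obtain ⟨b, hb, z, hz⟩ := zLoc_exists_den s
    refine ⟨b, hb, z, ?_⟩
    rw [map_intCast, ← map_natCast (algebraMap (zLoc p) (localRing α β p)), ← map_mul, hz]
    simp
  | add y y' _ _ h h' =>
    obtain ⟨b, hb, x, hx⟩ := h
    obtain ⟨b', hb', x', hx'⟩ := h'
    refine ⟨b * b', hb.mul_left hb', b' * x + b * x', ?_⟩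
    rw [map_add, map_mul, map_mul, ← hx, ← hx', map_natCast, map_natCast]
    push_cast
    ring
  | mul y y' _ _ h h' =>
    obtain ⟨b, hb, x, hx⟩ := h
    obtain ⟨b', hb', x', hx'⟩ := h'
    refine ⟨b * b', hb.mul_left hb', x * x', ?_⟩
    rw [map_mul, ← hx, ← hx']
    push_cast
    ring

lemma localRing_isUnit_of_ne (hp : p.Prime) (q : ℕ) (hq : q.Prime) (hqp : q ≠ p) :
    IsUnit (q : localRing α β p) := by
  simpa using (zLoc_isUnit_of_ne hp q hq hqp).map (algebraMap (zLoc p) (localRing α β p))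

instance : Module.Finite ℤ (AdjoinRoot (cubic ℤ α β)) := (monic_cubic ℤ α β).finite_adjoinRoot

lemma finite_idealsOfIndex_localRing (hp : p.Prime) {n : ℕ} (hn : n ≠ 0) :
    (idealsOfIndex (localRing α β p) n).Finite :=
  finite_idealsOfIndex_of_den (toLocalRing α β p) localRing_exists_den
    (localRing_isUnit_of_ne hp) (fun _ => finite_idealsOfIndex_of_finite _) hn

/-- The zeta function of `R_p` is the Euler factor of that of `Λ`. -/
lemma ringZeta_localRing (hα : α ≠ 0) (hβ : β ≠ 0) (hαβ : α ≠ β) (hp : p.Prime) :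
    ringZeta (localRing α β p) = ArithmeticFunction.ofPowerSeries p
      (eulerSeries p (ringZeta (AdjoinRoot (cubic ℤ α β)))) := by
  rw [eq_ofPowerSeries_eulerSeries hp.one_lt (ringZeta (localRing α β p))
    (ringZeta_eq_zero_of_not_pow (localRing_isUnit_of_ne hp))]
  congr 1
  ext k
  rw [coeff_eulerSeries, coeff_eulerSeries, ringZeta_prime_pow_eq (toLocalRing α β p) hp
    (toLocalRing_injective hα hβ hαβ) localRing_exists_den]

/-- The count of sublattices applies to the image of `R_p` in `ℤ_(p)^3`, with `p^r` the `p`-part of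
`αβ(β - α)`. -/
lemma eulerSeries_ringZeta_cubic_mul_mem_polySeries
    (hα : α ≠ 0) (hβ : β ≠ 0) (hαβ : α ≠ β) (hp : p.Prime) :
    eulerSeries p (ringZeta (AdjoinRoot (cubic ℤ α β))) * (1 - PowerSeries.X) ^ 3 ∈
      polySeries := by
  have hD : (rootProduct α β : zLoc p) ≠ 0 := by
    exact_mod_cast rootProduct_ne_zero hα hβ hαβ
  obtain ⟨r, u, hu⟩ := zLoc_exists_eq_unit_mul_pow hp hD
  let Λ := (cubicEvals (zLoc p) α β).range
  let e : localRing α β p ≃ₐ[zLoc p] Λ :=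
    AlgEquiv.ofInjective _ (cubicEvals_injective (zLoc p) hα hβ hαβ)
  have hr : ∀ x : Fin 3 → zLoc p, (p : zLoc p) ^ r • x ∈ Λ := by
    intro x
    rw [← hu, ← smul_smul]
    exact rootProduct_smul_mem_range _ _ _ _
  have h := mk_ncard_idealsOfIndex_mul_mem_polySeries hp hr
  rw [Fintype.card_fin] at h
  convert h using 2
  ext k
  rw [coeff_eulerSeries, PowerSeries.coeff_mk,
    ringZeta_prime_pow_eq (toLocalRing α β p) hp (toLocalRing_injective hα hβ hαβ)
      localRing_exists_den, ringZeta_apply (pow_ne_zero k hp.ne_zero),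
    ncard_idealsOfIndex_congr e.toRingEquiv]

/-- Here `αβ(β - α)` is a unit of `ℤ_(p)`, so `R_p` is isomorphic to `ℤ_(p)^3`. -/
lemma eulerSeries_ringZeta_cubic_mul_eq_one
    (hα : α ≠ 0) (hβ : β ≠ 0) (hαβ : α ≠ β) (hp : p.Prime) (hpD : ¬ (p : ℤ) ∣ rootProduct α β) :
    eulerSeries p (ringZeta (AdjoinRoot (cubic ℤ α β))) * (1 - PowerSeries.X) ^ 3 = 1 := by
  let e : localRing α β p ≃+* (Fin 3 → zLoc p) :=
    RingEquiv.ofBijective (cubicEvals (zLoc p) α β) ⟨cubicEvals_injective (zLoc p) hα hβ hαβ,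
      cubicEvals_surjective _ _ _ (zLoc_isUnit_intCast hp hpD)⟩
  let e' : (Fin 3 → zLoc p) ≃+* zLoc p × zLoc p × zLoc p :=
    { toFun := fun x => (x 0, x 1, x 2)
      invFun := fun x => ![x.1, x.2.1, x.2.2]
      left_inv := fun x => by funext i; fin_cases i <;> rfl
      right_inv := fun _ => rfl
      map_mul' := fun _ _ => rfl
      map_add' := fun _ _ => rfl }
  have hfin : ∀ d, d ≠ 0 → (idealsOfIndex (zLoc p) d).Finite :=
    fun _ => finite_idealsOfIndex_zLoc hp
  have h := ringZeta_localRing hα hβ hαβ hp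
  rw [ringZeta_congr (e.trans e'), ringZeta_prod hfin fun _ => finite_idealsOfIndex_prod hfin hfin,
    ringZeta_prod hfin hfin, ringZeta_zLoc hp, ← map_mul, ← map_mul] at h
  have h' := congrArg (eulerSeries p) h
  rw [eulerSeries_ofPowerSeries hp.one_lt, eulerSeries_ofPowerSeries hp.one_lt] at h'
  rw [← h', ← pow_two, ← pow_succ', ← mul_pow, eulerSeries_zeta_mul hp, one_pow]

end Local

/-! ### The ring `ℤ[B]` -/

/-- `ℤ[B]` is isomorphic to `ℤ[x] / x (x - α) (x - β)`. -/
lemma nonempty_adjoin_ringEquiv {v : ℕ} {B : Matrix (Fin v) (Fin v) ℤ} {α β : ℤ}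
    (hB : minpoly ℚ (B.map (Int.cast : ℤ → ℚ)) = cubic ℚ α β) :
    Nonempty (AdjoinRoot (cubic ℤ α β) ≃+* Algebra.adjoin ℤ {B}) := by
  let B' : Algebra.adjoin ℤ {B} := ⟨B, Algebra.self_mem_adjoin_singleton ℤ B⟩
  let f : ℤ[X] →ₐ[ℤ] Algebra.adjoin ℤ {B} := aeval B'
  have hf : Function.Surjective f := by
    rintro ⟨x, hx⟩
    rw [Algebra.adjoin_singleton_eq_range_aeval] at hx
    obtain ⟨g, rfl⟩ := hx
    exact ⟨g, Subtype.ext (aeval_subalgebra_coe g _ B')⟩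
  let φ : Matrix (Fin v) (Fin v) ℤ →ₐ[ℤ] Matrix (Fin v) (Fin v) ℚ :=
    (Int.castRingHom ℚ).mapMatrix.toIntAlgHom
  have hφ : Function.Injective φ := Matrix.map_injective Int.cast_injective
  have hcast : ∀ g : ℤ[X], f g = 0 ↔
      aeval (B.map (Int.cast : ℤ → ℚ)) (g.map (Int.castRingHom ℚ)) = 0 := by
    intro g
    rw [← algebraMap_int_eq, aeval_map_algebraMap]
    change _ ↔ aeval (φ B) g = 0
    rw [aeval_algHom_apply, map_eq_zero_iff φ hφ, ← aeval_subalgebra_coe g _ B',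
      ZeroMemClass.coe_eq_zero]
  -- Divisibility of integral polynomials by a monic integral polynomial is the same over `ℤ` and
  -- over `ℚ`.
  have hker : Ideal.span {cubic ℤ α β} = RingHom.ker (f : ℤ[X] →+* Algebra.adjoin ℤ {B}) := by
    ext g
    rw [RingHom.mem_ker, Ideal.mem_span_singleton]
    change _ ↔ f g = 0
    rw [hcast, ← minpoly.dvd_iff, hB, ← map_cubic (Int.castRingHom ℚ)]
    exact (Polynomial.map_dvd_map _ Int.cast_injective (monic_cubic ℤ α β)).symm
  exact ⟨(Ideal.quotEquivOfEq hker).trans (RingHom.quotientKerEquivOfSurjective hf)⟩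

end Cubic

/-! ### Orders of `A` -/

section Orders

variable (S : Type*) [CommRing S] [Algebra S ℚ] (α β : ℤ)

/-- The elements of `A` whose values at the three roots lie in `S`. -/
def maxOrder : Subalgebra S (cubicAlgebra α β) :=
  ⨅ i, (⊥ : Subalgebra S ℚ).comap ((cubicEval ℚ α β i).restrictScalars S)

variable {S α β}

lemma mem_maxOrder {x : cubicAlgebra α β} :
    x ∈ maxOrder S α β ↔ ∀ i, ∃ s : S, algebraMap S ℚ s = cubicEval ℚ α β i x := by
  simp only [maxOrder, Algebra.mem_iInf]
  rfl

variable (α β) in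
/-- The primitive idempotents of `A`. -/
def cubicIdempotent (i : Fin 3) : cubicAlgebra α β :=
  (rootProduct α β : ℚ)⁻¹ • lagrange α β (AdjoinRoot.root (cubic ℚ α β)) i

lemma cubicEval_cubicIdempotent (hD : rootProduct α β ≠ 0) (i j : Fin 3) :
    cubicEval ℚ α β j (cubicIdempotent α β i) = if i = j then 1 else 0 := by
  have hD' : (rootProduct α β : ℚ) ≠ 0 := by exact_mod_cast hD
  rw [cubicIdempotent, map_smul, cubicEval_lagrange]
  split_ifs <;> simp [hD']

lemma rootProduct_smul_cubicIdempotent (hD : rootProduct α β ≠ 0) (i : Fin 3) :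
    (rootProduct α β : ℤ) • cubicIdempotent α β i =
      lagrange α β (AdjoinRoot.root (cubic ℚ α β)) i := by
  have hD' : (rootProduct α β : ℚ) ≠ 0 := by exact_mod_cast hD
  rw [cubicIdempotent, ← Int.cast_smul_eq_zsmul ℚ, smul_smul, mul_inv_cancel₀ hD', one_smul]

lemma eq_sum_cubicIdempotent (hα : α ≠ 0) (hβ : β ≠ 0) (hαβ : α ≠ β) (x : cubicAlgebra α β) :
    x = ∑ i, cubicEval ℚ α β i x • cubicIdempotent α β i := by
  refine cubicEvals_injective ℚ hα hβ hαβ (funext fun j => ?_)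
  rw [cubicEvals_apply, cubicEvals_apply, map_sum, Finset.sum_eq_single j]
  · rw [map_smul, cubicEval_cubicIdempotent (rootProduct_ne_zero hα hβ hαβ), if_pos rfl,
      smul_eq_mul, mul_one]
  · intro i _ hij
    rw [map_smul, cubicEval_cubicIdempotent (rootProduct_ne_zero hα hβ hαβ), if_neg hij, smul_zero]
  · simp

lemma cubicIdempotent_mem_maxOrder (hD : rootProduct α β ≠ 0) (i : Fin 3) :
    cubicIdempotent α β i ∈ maxOrder S α β := by
  refine mem_maxOrder.2 fun j => ⟨if i = j then 1 else 0, ?_⟩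
  rw [cubicEval_cubicIdempotent hD]
  split_ifs <;> simp

lemma exists_eq_sum_smul (hα : α ≠ 0) (hβ : β ≠ 0) (hαβ : α ≠ β) {x : cubicAlgebra α β}
    (hx : x ∈ maxOrder S α β) : ∃ s : Fin 3 → S, x = ∑ i, s i • cubicIdempotent α β i := by
  choose s hs using mem_maxOrder.1 hx
  refine ⟨s, ?_⟩
  refine (eq_sum_cubicIdempotent hα hβ hαβ x).trans ?_
  refine Finset.sum_congr rfl fun i _ => ?_
  rw [← hs i, algebraMap_smul]

lemma isOrder_maxOrder (hα : α ≠ 0) (hβ : β ≠ 0) (hαβ : α ≠ β) : IsOrder (maxOrder S α β) := by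
  have hD := rootProduct_ne_zero hα hβ hαβ
  constructor
  · have h : Subalgebra.toSubmodule (maxOrder S α β) =
        Submodule.span S (Set.range (cubicIdempotent α β)) := by
      refine le_antisymm (fun x hx => ?_) (Submodule.span_le.2 ?_)
      · obtain ⟨s, rfl⟩ := exists_eq_sum_smul hα hβ hαβ hx
        exact sum_mem fun i _ => Submodule.smul_mem _ _ (Submodule.subset_span ⟨i, rfl⟩)
      · rintro _ ⟨i, rfl⟩
        exact cubicIdempotent_mem_maxOrder hD i
    rw [h]
    exact Submodule.fg_span (Set.finite_range _)
  · refine Submodule.eq_top_iff'.2 fun x => ?_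
    rw [eq_sum_cubicIdempotent hα hβ hαβ x]
    exact sum_mem fun i _ => Submodule.smul_mem _ _
      (Submodule.subset_span (cubicIdempotent_mem_maxOrder hD i))

/-- Elements of an order are integral over `S`, so their values at the roots are integral elements
of `ℚ`, hence in `S`. This makes the maximal order unique. -/
lemma le_maxOrder_of_isOrder [IsDomain S] [IsFractionRing S ℚ] [IsIntegrallyClosed S]
    {O : Subalgebra S (cubicAlgebra α β)} (hO : IsOrder O) : O ≤ maxOrder S α β := by
  intro x hx
  refine mem_maxOrder.2 fun i => ?_
  have h1 : IsIntegral S x := IsIntegral.of_mem_of_fg O hO.1 x hx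
  exact IsIntegrallyClosed.isIntegral_iff.1 (h1.map ((cubicEval ℚ α β i).restrictScalars S))

lemma isMaximalOrder_maxOrder [IsDomain S] [IsFractionRing S ℚ] [IsIntegrallyClosed S]
    (hα : α ≠ 0) (hβ : β ≠ 0) (hαβ : α ≠ β) : IsMaximalOrder (maxOrder S α β) :=
  ⟨isOrder_maxOrder hα hβ hαβ, fun _ hO h => le_antisymm (le_maxOrder_of_isOrder hO) h⟩

lemma eq_maxOrder_of_isMaximalOrder [IsDomain S] [IsFractionRing S ℚ] [IsIntegrallyClosed S]
    (hα : α ≠ 0) (hβ : β ≠ 0) (hαβ : α ≠ β) {O : Subalgebra S (cubicAlgebra α β)}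
    (hO : IsMaximalOrder O) : O = maxOrder S α β :=
  (hO.2 _ (isOrder_maxOrder hα hβ hαβ) (le_maxOrder_of_isOrder hO.1)).symm

lemma root_mem_cubicOrder : AdjoinRoot.root (cubic ℚ α β) ∈ cubicOrder S α β :=
  Algebra.self_mem_adjoin_singleton S _

lemma cubicOrder_le_maxOrder : cubicOrder S α β ≤ maxOrder S α β := by
  refine Algebra.adjoin_le (Set.singleton_subset_iff.2 (mem_maxOrder.2 fun i => ?_))
  exact ⟨cubicRoot α β i, by simp⟩

lemma lagrange_mem_cubicOrder (i : Fin 3) :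
    lagrange α β (AdjoinRoot.root (cubic ℚ α β)) i ∈ cubicOrder S α β := by
  have h := root_mem_cubicOrder (S := S) (α := α) (β := β)
  have hz := fun n : ℤ => intCast_mem (cubicOrder S α β) n
  fin_cases i
  · exact mul_mem (sub_mem (hz _) (hz _)) (mul_mem (sub_mem h (hz _)) (sub_mem h (hz _)))
  · exact mul_mem (neg_mem (hz _)) (mul_mem h (sub_mem h (hz _)))
  · exact mul_mem (hz _) (mul_mem h (sub_mem h (hz _)))

/-- The idempotents span the maximal order, and `αβ(β - α)` turns each into an integral polynomial
in the root. -/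
lemma rootProduct_smul_mem_cubicOrder (hα : α ≠ 0) (hβ : β ≠ 0) (hαβ : α ≠ β)
    {x : cubicAlgebra α β} (hx : x ∈ maxOrder S α β) :
    rootProduct α β • x ∈ cubicOrder S α β := by
  obtain ⟨s, rfl⟩ := exists_eq_sum_smul hα hβ hαβ hx
  rw [Finset.smul_sum]
  refine sum_mem fun i _ => ?_
  rw [smul_comm, rootProduct_smul_cubicIdempotent (rootProduct_ne_zero hα hβ hαβ)]
  exact Subalgebra.smul_mem _ (lagrange_mem_cubicOrder i) _

lemma exists_dvd_cubicRoot_sub {p : ℕ} (hp : p.Prime) (h : (p : ℤ) ∣ rootProduct α β) :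
    ∃ i j, i ≠ j ∧ (p : ℤ) ∣ cubicRoot α β i - cubicRoot α β j := by
  have hp' := Nat.prime_iff_prime_int.1 hp
  rcases hp'.dvd_or_dvd h with h | h
  · rcases hp'.dvd_or_dvd h with h | h
    · exact ⟨1, 0, by decide, by simpa [cubicRoot] using h⟩
    · exact ⟨2, 0, by decide, by simpa [cubicRoot] using h⟩
  · exact ⟨2, 1, by decide, by simpa [cubicRoot] using h⟩

/-- The values of an element of `Λ` at two roots are congruent modulo the difference
of the roots. -/
lemma exists_cubicEval_sub_eq {x : cubicAlgebra α β} (hx : x ∈ cubicOrder S α β) (i j : Fin 3) :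
    ∃ s : S, cubicEval ℚ α β i x - cubicEval ℚ α β j x =
      algebraMap S ℚ (((cubicRoot α β i - cubicRoot α β j : ℤ) : S) * s) := by
  rw [cubicOrder, Algebra.adjoin_singleton_eq_range_aeval] at hx
  obtain ⟨g, rfl⟩ := hx
  have h : ∀ k, cubicEval ℚ α β k (aeval (AdjoinRoot.root (cubic ℚ α β)) g) =
      algebraMap S ℚ (g.eval (cubicRoot α β k : S)) := by
    intro k
    have h1 := aeval_algHom_apply ((cubicEval ℚ α β k).restrictScalars S)
      (AdjoinRoot.root (cubic ℚ α β)) g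
    rw [AlgHom.restrictScalars_apply, AlgHom.restrictScalars_apply, cubicEval_root] at h1
    rw [← h1, ← aeval_algebraMap_apply_eq_algebraMap_eval, map_intCast]
  obtain ⟨s, hs⟩ := sub_dvd_eval_sub (cubicRoot α β i : S) (cubicRoot α β j : S) g
  refine ⟨s, ?_⟩
  change cubicEval ℚ α β i (aeval _ g) - cubicEval ℚ α β j (aeval _ g) = _
  rw [h, h, ← map_sub, hs, Int.cast_sub]

/-- If `p ∣ αβ(β - α)`, some idempotent `e` of `A` satisfies `n e ∈ Λ` only for `p ∣ n`. -/
lemma exists_cubicIdempotent_dvd [IsFractionRing S ℚ] (hD : rootProduct α β ≠ 0) {p : ℕ}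
    (hp : p.Prime) (hpD : (p : ℤ) ∣ rootProduct α β) :
    ∃ i, ∀ n : ℕ, n • cubicIdempotent α β i ∈ cubicOrder S α β → (p : S) ∣ (n : S) := by
  -- For roots `i ≠ j` congruent modulo `p`, the values `n` and `0` of `n e_i` at them must be
  -- congruent modulo `p`.
  obtain ⟨i, j, hij, c, hc⟩ := exists_dvd_cubicRoot_sub hp hpD
  refine ⟨i, fun n hn => ?_⟩
  obtain ⟨s, hs⟩ := exists_cubicEval_sub_eq hn i j
  rw [map_nsmul, map_nsmul, cubicEval_cubicIdempotent hD, cubicEval_cubicIdempotent hD, if_pos rfl,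
    if_neg hij, nsmul_one, nsmul_zero, sub_zero, hc, ← map_natCast (algebraMap S ℚ)] at hs
  refine ⟨c * s, ?_⟩
  rw [IsFractionRing.injective S ℚ hs]
  push_cast
  ring

end Orders

lemma exceptionalPrimes_eq {α β : ℤ} (hα : α ≠ 0) (hβ : β ≠ 0) (hαβ : α ≠ β) :
    exceptionalPrimes α β = {p : ℕ | p.Prime ∧ (p : ℤ) ∣ rootProduct α β} := by
  ext p
  refine and_congr_right fun hp => ?_
  have := zLoc_isFractionRing hp
  have := zLoc_isIntegrallyClosed hp
  have hD := rootProduct_ne_zero hα hβ hαβ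
  constructor
  · contrapose
    intro hpD
    have h : cubicOrder (zLoc p) α β = maxOrder (zLoc p) α β := by
      refine le_antisymm cubicOrder_le_maxOrder fun x hx => ?_
      obtain ⟨u, hu⟩ := zLoc_isUnit_intCast hp hpD
      have h1 := Subalgebra.smul_mem _ (rootProduct_smul_mem_cubicOrder hα hβ hαβ hx) (↑u⁻¹ : zLoc p)
      rwa [← Int.cast_smul_eq_zsmul (zLoc p), ← hu, smul_smul, Units.inv_mul, one_smul] at h1
    rw [h]
    exact isMaximalOrder_maxOrder hα hβ hαβ
  · intro hpD h
    have h1 := eq_maxOrder_of_isMaximalOrder hα hβ hαβ h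
    obtain ⟨i, hi⟩ := exists_cubicIdempotent_dvd (S := zLoc p) hD hp hpD
    -- If `Λ_p` were maximal it would contain the idempotent itself, forcing `p ∣ 1` in `ℤ_(p)`.
    have h2 := hi 1 (by rw [one_smul, h1]; exact cubicIdempotent_mem_maxOrder hD i)
    have h3 := (zLoc_pow_dvd_pow hp (k := 1) (l := 0)).1 (by simpa using h2)
    omega

/-! ### The index of `Λ` in its maximal order. -/

section Index

variable {α β : ℤ}

/-- The quotient is finitely generated over `ℤ` and killed by `αβ(β - α) ≠ 0`. -/
lemma orderIndex_ne_zero (hα : α ≠ 0) (hβ : β ≠ 0) (hαβ : α ≠ β) :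
    orderIndex (cubicOrder ℤ α β) (maxOrder ℤ α β) ≠ 0 := by
  let N := Subalgebra.toSubmodule (maxOrder ℤ α β)
  let K := (Subalgebra.toSubmodule (cubicOrder ℤ α β)).comap N.subtype
  have : Module.Finite ℤ N := Module.Finite.iff_fg.2 (isOrder_maxOrder hα hβ hαβ).1
  have hfin : Finite (N ⧸ K) := by
    refine Module.finite_of_fg_torsion _ fun x => ?_
    obtain ⟨⟨x, hx⟩, rfl⟩ := K.mkQ_surjective x
    refine ⟨⟨rootProduct α β, by simpa using rootProduct_ne_zero hα hβ hαβ⟩, ?_⟩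
    change rootProduct α β • K.mkQ _ = 0
    rw [← map_smul, K.mkQ_apply, Submodule.Quotient.mk_eq_zero]
    exact rootProduct_smul_mem_cubicOrder hα hβ hαβ hx
  exact AddSubgroup.index_ne_zero_of_finite (hH := hfin)

/-- An element of order `p` in the quotient is also killed by `αβ(β - α)`, which therefore cannot be
prime to `p`. Conversely the index carries every idempotent into `Λ`, so `p` divides it by
`exists_cubicIdempotent_dvd`. -/
lemma prime_dvd_orderIndex_iff (hα : α ≠ 0) (hβ : β ≠ 0) (hαβ : α ≠ β) {p : ℕ} (hp : p.Prime) :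
    p ∣ orderIndex (cubicOrder ℤ α β) (maxOrder ℤ α β) ↔ (p : ℤ) ∣ rootProduct α β := by
  have hD := rootProduct_ne_zero hα hβ hαβ
  constructor
  · intro h
    obtain ⟨⟨y, hyN⟩, hy, hpy⟩ := exists_nsmul_mem_of_dvd_index
      (orderIndex_ne_zero hα hβ hαβ) hp h
    by_contra hpD
    have hcop : IsCoprime (p : ℤ) (rootProduct α β) :=
      (Nat.prime_iff_prime_int.1 hp).coprime_iff_not_dvd.2 hpD
    obtain ⟨u, w, huw⟩ := hcop
    have h1 : p • y ∈ cubicOrder ℤ α β := hpy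
    have h2 := rootProduct_smul_mem_cubicOrder hα hβ hαβ (S := ℤ) hyN
    refine hy ?_
    change y ∈ cubicOrder ℤ α β
    have h3 : y = u • (p • y) + w • (rootProduct α β • y) := by
      rw [← natCast_zsmul, smul_smul, smul_smul, ← add_smul, huw, one_smul]
    rw [h3]
    exact add_mem (zsmul_mem h1 u) (zsmul_mem h2 w)
  · intro hpD
    obtain ⟨i, hi⟩ := exists_cubicIdempotent_dvd (S := ℤ) hD hp hpD
    have h1 := AddSubgroup.nsmul_index_mem
      ((Subalgebra.toSubmodule (cubicOrder ℤ α β)).toAddSubgroup.addSubgroupOf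
        (Subalgebra.toSubmodule (maxOrder ℤ α β)).toAddSubgroup)
      ⟨cubicIdempotent α β i, cubicIdempotent_mem_maxOrder hD i⟩
    exact_mod_cast hi _ h1

end Index

/-! ### The zeta function of the regular module -/

/-- The Dedekind zeta function of a field isomorphic to `ℚ` is `ζ(s)`. -/
lemma ringZeta_integralClosure_of_ringEquiv {K : Type*} [CommRing K] (σ : K ≃+* ℚ) :
    ringZeta (integralClosure ℤ K) = (ArithmeticFunction.zeta : ArithmeticFunction ℤ) := by
  have hbij : Function.Bijective (Int.castRingHom (integralClosure ℤ K)) := by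
    constructor
    · intro a b h
      have h1 := congrArg (fun y : integralClosure ℤ K => σ (y : K)) h
      simpa using h1
    · rintro ⟨x, hx⟩
      have h1 : IsIntegral ℤ (σ x) := IsIntegral.map σ.toRingHom.toIntAlgHom hx
      obtain ⟨z, hz⟩ := IsIntegrallyClosed.isIntegral_iff.1 h1
      refine ⟨z, Subtype.ext (σ.injective ?_)⟩
      rw [← hz]
      simp
  rw [← ringZeta_int, ringZeta_congr (RingEquiv.ofBijective _ hbij)]

section

variable {α β : ℤ}

lemma cubicEval_rat_surjective (i : Fin 3) : Function.Surjective (cubicEval ℚ α β i) :=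
  fun q => ⟨algebraMap ℚ _ q, AlgHom.commutes _ q⟩

lemma ker_cubicEval_isMaximal (i : Fin 3) : (RingHom.ker (cubicEval ℚ α β i)).IsMaximal :=
  RingHom.ker_isMaximal_of_surjective _ (cubicEval_rat_surjective i)

lemma ker_cubicEval_le {i : Fin 3} {I : Ideal (cubicAlgebra α β)}
    (h : AdjoinRoot.root (cubic ℚ α β) - (cubicRoot α β i : cubicAlgebra α β) ∈ I) :
    RingHom.ker (cubicEval ℚ α β i) ≤ I := by
  intro x hx
  obtain ⟨g, rfl⟩ := AdjoinRoot.mk_surjective x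
  rw [RingHom.mem_ker, cubicEval_mk] at hx
  obtain ⟨g, rfl⟩ := dvd_iff_isRoot.2 hx
  rw [map_mul]
  exact I.mul_mem_right _ (by simpa using h)

lemma cubicRoot_injective (hα : α ≠ 0) (hβ : β ≠ 0) (hαβ : α ≠ β) :
    Function.Injective (cubicRoot α β) := by
  intro i j h
  fin_cases i <;> fin_cases j <;> simp_all [cubicRoot, eq_comm]

/-- The maximal ideals of `A` are the kernels of the evaluations at the three roots. -/
lemma bijective_ker_cubicEval (hα : α ≠ 0) (hβ : β ≠ 0) (hαβ : α ≠ β) :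
    Function.Bijective fun i => (⟨_, ker_cubicEval_isMaximal i⟩ :
      MaximalSpectrum (cubicAlgebra α β)) := by
  constructor
  · intro i j h
    have hker : RingHom.ker (cubicEval ℚ α β i) = RingHom.ker (cubicEval ℚ α β j) :=
      congrArg MaximalSpectrum.asIdeal h
    have hi : AdjoinRoot.root (cubic ℚ α β) - (cubicRoot α β i : cubicAlgebra α β) ∈
        RingHom.ker (cubicEval ℚ α β i) := by
      simp [RingHom.mem_ker]
    rw [hker, RingHom.mem_ker, map_sub, cubicEval_root, map_intCast, sub_eq_zero] at hi
    exact cubicRoot_injective hα hβ hαβ (by exact_mod_cast hi.symm)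
  · rintro ⟨m, hm⟩
    have h0 : AdjoinRoot.root (cubic ℚ α β) *
        (AdjoinRoot.root (cubic ℚ α β) - (α : cubicAlgebra α β)) *
        (AdjoinRoot.root (cubic ℚ α β) - (β : cubicAlgebra α β)) ∈ m := by
      rw [← aeval_cubic ℚ, AdjoinRoot.aeval_eq, AdjoinRoot.mk_self]
      exact m.zero_mem
    have h1 : ∃ i, AdjoinRoot.root (cubic ℚ α β) - (cubicRoot α β i : cubicAlgebra α β) ∈ m := by
      rcases hm.isPrime.mem_or_mem h0 with h | h
      · rcases hm.isPrime.mem_or_mem h with h | h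
        · exact ⟨0, by simpa [cubicRoot] using h⟩
        · exact ⟨1, by simpa [cubicRoot] using h⟩
      · exact ⟨2, by simpa [cubicRoot] using h⟩
    obtain ⟨i, hi⟩ := h1
    refine ⟨i, ?_⟩
    rw [MaximalSpectrum.ext_iff]
    exact (ker_cubicEval_isMaximal i).eq_of_le hm.ne_top (ker_cubicEval_le hi)

/-- There is one maximal ideal for each root, with residue field `ℚ`. -/
lemma regularZeta_cubicAlgebra (hα : α ≠ 0) (hβ : β ≠ 0) (hαβ : α ≠ β) :
    regularZeta (cubicAlgebra α β) = (ArithmeticFunction.zeta : ArithmeticFunction ℤ) ^ 3 := by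
  have h : ∀ i, ringZeta (integralClosure ℤ
      (cubicAlgebra α β ⧸ RingHom.ker (cubicEval ℚ α β i))) =
      (ArithmeticFunction.zeta : ArithmeticFunction ℤ) := fun i =>
    ringZeta_integralClosure_of_ringEquiv
      (RingHom.quotientKerEquivOfSurjective (f := (cubicEval ℚ α β i : cubicAlgebra α β →+* ℚ))
        (cubicEval_rat_surjective i))
  rw [regularZeta, ← finprod_comp _ (bijective_ker_cubicEval hα hβ hαβ)]
  refine (finprod_congr h).trans ?_
  rw [finprod_eq_prod_of_fintype, Finset.prod_const, Finset.card_univ, Fintype.card_fin]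

end

end IdealZeta

end

/-! ### Assembly of the theorem. -/

theorem mainTheorem6 (v : ℕ) (B : Matrix (Fin v) (Fin v) ℤ) (α β : ℤ)
    (hα : α ≠ 0) (hβ : β ≠ 0) (hαβ : α ≠ β)
    (hB : minpoly ℚ (B.map (Int.cast : ℤ → ℚ)) = cubic ℚ α β) :
    -- the coefficients of the Dirichlet series are well defined
    (∀ n : ℕ, 0 < n → (idealsOfIndex (Algebra.adjoin ℤ {B}) n).Finite) ∧
    (∀ p n : ℕ, p.Prime → 0 < n → (idealsOfIndex (localRing α β p) n).Finite) ∧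
    -- the exceptional primes are the prime divisors of `αβ(β - α)`; they are also the prime
    -- divisors of the index of `Λ` in a maximal order
    exceptionalPrimes α β = {p : ℕ | p.Prime ∧ (p : ℤ) ∣ α * β * (β - α)} ∧
    (∃ Γ : Subalgebra ℤ (cubicAlgebra α β), IsMaximalOrder Γ ∧ cubicOrder ℤ α β ≤ Γ) ∧
    (∀ Γ : Subalgebra ℤ (cubicAlgebra α β), IsMaximalOrder Γ → cubicOrder ℤ α β ≤ Γ →
      orderIndex (cubicOrder ℤ α β) Γ ≠ 0 ∧
      ∀ p : ℕ, p.Prime →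
        (p ∣ orderIndex (cubicOrder ℤ α β) Γ ↔ (p : ℤ) ∣ α * β * (β - α))) ∧
    -- `ζ_V(s) = ζ(s)^3` and `ζ_V(s)_p = (1 - p^{-s})^{-3}`
    regularZeta (cubicAlgebra α β) = (ArithmeticFunction.zeta : ArithmeticFunction ℤ) ^ 3 ∧
    (∀ p : ℕ, p.Prime →
      eulerFactor p (regularZeta (cubicAlgebra α β)) * (1 - dirichletMonomial p) ^ 3 = 1) ∧
    -- the polynomials `δ_p`
    ∃ δ : ℕ → ℤ[X],
      (∀ p : ℕ, p.Prime →
        aeval (dirichletMonomial p) (δ p) =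
          ringZeta (localRing α β p) * (1 - dirichletMonomial p) ^ 3) ∧
      -- the factorisation, as formal Dirichlet series
      ringZeta (Algebra.adjoin ℤ {B}) =
        (∏ p ∈ (α * β * (β - α)).natAbs.primeFactors, aeval (dirichletMonomial p) (δ p)) *
          (ArithmeticFunction.zeta : ArithmeticFunction ℤ) ^ 3 ∧
      -- the factorisation, as functions of a complex variable
      ∀ s : ℂ, 1 < s.re →
        LSeriesSummable (fun n => ((ringZeta (Algebra.adjoin ℤ {B}) n : ℤ) : ℂ)) s ∧
        LSeries (fun n => ((ringZeta (Algebra.adjoin ℤ {B}) n : ℤ) : ℂ)) s =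
          (∏ p ∈ (α * β * (β - α)).natAbs.primeFactors, aeval ((p : ℂ) ^ (-s)) (δ p)) *
            riemannZeta s ^ 3 := by
  obtain ⟨e⟩ := nonempty_adjoin_ringEquiv hB
  have hzeta : ringZeta (Algebra.adjoin ℤ {B}) = ringZeta (AdjoinRoot (cubic ℤ α β)) :=
    ringZeta_congr e.symm
  have hfin : ∀ n, n ≠ 0 → (idealsOfIndex (AdjoinRoot (cubic ℤ α β)) n).Finite :=
    fun _ => finite_idealsOfIndex_of_finite _
  have hD : α * β * (β - α) ≠ 0 := rootProduct_ne_zero hα hβ hαβ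
  have hdvd : ∀ p : ℕ, p.Prime → (p ∈ (α * β * (β - α)).natAbs.primeFactors ↔
      (p : ℤ) ∣ rootProduct α β) := fun p hp => by
    rw [Nat.mem_primeFactors_of_ne_zero (Int.natAbs_ne_zero.2 hD), and_iff_right hp,
      ← Int.natCast_dvd]
    rfl
  have hδ : ∀ p : ℕ, ∃ δ : ℤ[X], p.Prime → (δ : PowerSeries ℤ) =
      eulerSeries p (ringZeta (AdjoinRoot (cubic ℤ α β))) * (1 - PowerSeries.X) ^ 3 := by
    intro p
    by_cases hp : p.Prime
    · obtain ⟨δ, hδ⟩ := exists_coe_eq_of_mem_polySeries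
        (eulerSeries_ringZeta_cubic_mul_mem_polySeries hα hβ hαβ hp)
      exact ⟨δ, fun _ => hδ⟩
    · exact ⟨0, fun h => absurd h hp⟩
  choose δ hδ using hδ
  have hfactor := eq_prod_aeval_mul_zeta_pow (ringZeta (AdjoinRoot (cubic ℤ α β)))
    (isMultiplicative_ringZeta hfin) 3 (α * β * (β - α)).natAbs δ hδ fun p hp hpN =>
      eulerSeries_ringZeta_cubic_mul_eq_one hα hβ hαβ hp fun h => hpN ((hdvd p hp).2 h)
  refine ⟨fun n hn => ?_, fun p n hp hn => finite_idealsOfIndex_localRing hp hn.ne',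
    exceptionalPrimes_eq hα hβ hαβ, ⟨_, isMaximalOrder_maxOrder hα hβ hαβ, cubicOrder_le_maxOrder⟩,
    fun Γ hΓ _ => ?_, regularZeta_cubicAlgebra hα hβ hαβ, fun p hp => ?_, δ, fun p hp => ?_, ?_,
    fun s hs => ?_⟩
  · exact finite_idealsOfIndex_of_surjective (q := (e : _ →+* Algebra.adjoin ℤ {B})) e.surjective
      (hfin n hn.ne')
  -- Uniqueness of the maximal order reduces the claim to `maxOrder`.
  · rw [eq_maxOrder_of_isMaximalOrder hα hβ hαβ hΓ]
    exact ⟨orderIndex_ne_zero hα hβ hαβ, fun p hp => prime_dvd_orderIndex_iff hα hβ hαβ hp⟩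
  · rw [regularZeta_cubicAlgebra hα hβ hαβ]
    exact eulerFactor_zeta_pow_mul hp 3
  · rw [aeval_dirichletMonomial hp.one_lt, hδ p hp, ringZeta_localRing hα hβ hαβ hp,
      dirichletMonomial_eq_ofPowerSeries hp.one_lt, map_mul, map_pow, map_sub, map_one]
  · rw [hzeta]
    exact hfactor
  · have h : HasLValue s (ringZeta (Algebra.adjoin ℤ {B}))
        ((∏ p ∈ (α * β * (β - α)).natAbs.primeFactors, aeval ((p : ℂ) ^ (-s)) (δ p)) *
          riemannZeta s ^ 3) := by
      rw [hzeta, hfactor]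
      exact (HasLValue.prod _ fun p hp => (HasLValue.dirichletMonomial s
        (Nat.prime_of_mem_primeFactors hp).ne_zero).aeval (δ p)).mul ((HasLValue.zeta hs).pow 3)
    exact ⟨h.LSeriesSummable, h.LSeries_eq⟩
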